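/- **Setting.** Let $\Omega\subset\mathbb R^n$ be open, $\Gamma=\partial\Omega$, $\delta(X)=\operatorname{dist}(X,\Gamma)$, let $m$ be a Borel measure on $\Omega$ and $\mu$ a locally finite Borel measure on $\mathbb R^n$. Balls $B(x,r)$ are open, and $2B$ is the ball with the center of $B$ and twice its radius. $C^\infty(\overline D)$, for $D$ open, is the space of smooth functions on $D$ all of whose derivatives extend continuously to $\overline D$. For $x\in\Gamma$, $r>0$ put $$\rho(x,r)=\frac{m(B(x,r)\cap\Omega)}{r\,\mu(B(x,r))}.$$ Assume that there are constants $C_1,\dots,C_6$ such that: * (H1) for all $x\in\Gamma$ and $r>0$ (only $r<\operatorname{diam}\Omega$ if $\Omega$ is bounded) there is $X\in B(x,r)$ with $B(X,C_1^{-1}r)\subset\Omega$; * (H2) $C_2=N+1$ is a positive integer, and whenever $r>0$ and $X,Y\in\Omega$ satisfy $\delta(X)>r$, $\delta(Y)>r$, $|X-Y|\le 7C_1r$, there are points $Z_0=X,Z_1,\dots,Z_N=Y$ of $\Omega$ with $|Z_i-Z_{i+1}|<\frac12\delta(Z_i)$ for $0\le i<N$; * (H3) the support of $\mu$ is $\Gamma$,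 and $\mu(B(x,2r))\le C_3\,\mu(B(x,r))$ for $x\in\Gamma$, $r>0$; * (H4) $dm=w\,dX$ on $\Omega$ with $w\in L^1_{loc}(\Omega)$, $w>0$ a.e., and $m(B(X,2r)\cap\Omega)\le C_4\,m(B(X,r)\cap\Omega)$ for $X\in\overline\Omega$, $r>0$; * (H5) $\dfrac{\rho(x,r)}{\rho(x,s)}\le C_5\left(\dfrac rs\right)^{1-\epsilon}$ for $x\in\Gamma$, $0<s<r$, where $\epsilon=C_5^{-1}>0$; * (H6) if $D$ is open with compact closure contained in $\Omega$, $u_i\in C^\infty(\overline D)$, $v\in L^2(D,m)$ is vector-valued, $\int_D|u_i|\,dm\to0$ and $\int_D|\nabla u_i-v|^2dm\to0$, then $v=0$ $m$-a.e. in $D$; moreover, for every ball $B$ of radius $r$ with $2B\subset\Omega$ and every $u\in C^\infty(\overline B)$, with $u_B=\frac1{m(B)}\int_Bu\,dm$ the $m$-average of $u$ on $B$, $$\frac1{m(B)}\int_B|u-u_B|\,dm\le C_6\,r\Big(\frac1{m(B)}\int_B|\nabla u|^2dm\Big)^{1/2}.$$ **Spaces.** $W$ is the space of $u\in L^1_{loc}(\Omega,m)$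 for which there are a vector field $v\in L^2(\Omega,m)$ and functions $\varphi_i\in C^\infty(\overline\Omega)$ with $\nabla\varphi_i\in L^2(\Omega,m)$, $\int_B|\varphi_i-u|\,dm\to0$ for every ball $B$ with $2B\subset\Omega$, and $\int_\Omega|\nabla\varphi_i-v|^2dm\to0$. By (H6) $v$ is unique; write $\nabla u=v$ and $\|u\|_W=\|\nabla u\|_{L^2(\Omega,m)}$. $H$ is the space of $\mu$-measurable $g:\Gamma\to\mathbb R$ with $$\|g\|_H^2=\int_\Gamma\int_\Gamma\frac{\rho(x,|x-y|)^2\,|g(x)-g(y)|^2}{m(B(x,|x-y|)\cap\Omega)}\,d\mu(y)\,d\mu(x)<\infty,$$ where the integrand is $0$ for $x=y$. Functions in $W$ (resp. $H$) are identified when they agree $m$-a.e. (resp. $\mu$-a.e.). **Cones.** Fix a dyadic system on $\Gamma$: for each $k\in\mathbb Z$ a partition $\mathbb D_k$ of $\Gamma$ into Borel sets of diameter at most $2^{-k}$, such that for $\ell\ge k$ each $P\in\mathbb D_\ell$ and $Q\in\mathbb D_k$ satisfy $P\subset Q$ or $P\cap Q=\emptyset$, for $\ell<k$ each $Q\in\mathbb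 D_k$ lies in a unique element of $\mathbb D_\ell$, and, for some $a_0>0$, each $Q\in\mathbb D_k$ contains $B(z,a_02^{-k})\cap\Gamma$ for some $z\in\Gamma$. For $Q\in\mathbb D_k$ put $\ell(Q)=2^{-k}$. Let $\mathcal W$ be the collection of closed dyadic cubes $I\subset\Omega$ of $\mathbb R^n$ (side length $\ell(I)$) such that $4\operatorname{diam}I\le\operatorname{dist}(4I,\Gamma)$, while the dyadic parent of $I$ does not have this property; here $4I$ has the center of $I$ and four times its side length. Fix $C_a\ge1000\,C_1\sqrt n$. Let $U_Q$ be the union of the $I\in\mathcal W$ with $\ell(I)\ge C_a^{-1}\ell(Q)$ and $\operatorname{dist}(I,Q)\le2\ell(Q)$, and for $x\in\Gamma$ let $\gamma(x)$ be the union of the $U_Q$ over all $k\in\mathbb Z$ and all $Q\in\mathbb D_k$ containing $x$. **Theorem.** There are a linear operator $\operatorname{Tr}:W\to H$ and a constant $C$ such that $\|\operatorname{Tr}u\|_H\le C\|u\|_W$ for all $u\in W$, and such that for every $u\in W$ and $\mu$-almost every $x\in\Gamma$, $$\operatorname{Tr}u(x)=\lim_{\substack{X\in\gamma(x)\\ \delta(X)\to0}}\frac1{m(B_X)}\int_{B_X}u\,dm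 \qquad\text{and}\qquad \lim_{\substack{X\in\gamma(x)\\ \delta(X)\to0}}\frac1{m(B_X)}\int_{B_X}|u(Z)-\operatorname{Tr}u(x)|\,dm(Z)=0,$$ where $B_X=B(X,\delta(X)/2)$. -/

import Mathlib

open MeasureTheory Filter Topology Metric
open scoped ENNReal NNReal ContDiff

/-- Euclidean space `ℝⁿ`. -/
abbrev Rn (n : ℕ) := EuclideanSpace ℝ (Fin n)

namespace MixedDim

variable {n : ℕ}

/-- `Γ = ∂Ω`. -/
def bdry (Ω : TopologicalSpace.Opens (Rn n)) : Set (Rn n) := frontier (Ω : Set (Rn n))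

/-- `δ(X) = dist(X, Γ)`. -/
noncomputable def δ (Ω : TopologicalSpace.Opens (Rn n)) (X : Rn n) : ℝ := infDist X (bdry Ω)

/-- The real number `m(B(x,r) ∩ Ω)`. -/
noncomputable def mBall (Ω : TopologicalSpace.Opens (Rn n)) (m : Measure (Rn n))
    (x : Rn n) (r : ℝ) : ℝ := m.real (ball x r ∩ Ω)

/-- `ρ(x,r) = m(B(x,r) ∩ Ω) / (r μ(B(x,r)))`. -/
noncomputable def rho (Ω : TopologicalSpace.Opens (Rn n)) (m μ : Measure (Rn n))
    (x : Rn n) (r : ℝ) : ℝ := mBall Ω m x r / (r * μ.real (ball x r))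

/-- `u ∈ C^∞(closure D)` for an open set `D`: `u` is smooth in `D`, and each of its derivatives has
a continuous extension from `D` to the closure of `D`. The values of `u` outside `D` do not
matter. -/
def SmoothUpTo (D : Set (Rn n)) (u : Rn n → ℝ) : Prop :=
  ContDiffOn ℝ ∞ u D ∧ ∀ k : ℕ, ∃ g : Rn n → (Rn n [×k]→L[ℝ] ℝ),
    ContinuousOn g (closure D) ∧ Set.EqOn (iteratedFDeriv ℝ k u) g D

/-! ### The assumptions -/

/-- Corkscrew points. -/
def H1 (Ω : TopologicalSpace.Opens (Rn n)) (C₁ : ℝ) : Prop :=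
  0 < C₁ ∧ ∀ x ∈ bdry Ω, ∀ r : ℝ, 0 < r →
    (Bornology.IsBounded (Ω : Set (Rn n)) → r < diam (Ω : Set (Rn n))) →
    ∃ X ∈ ball x r, ball X (C₁⁻¹ * r) ⊆ Ω

/-- Harnack chains; `C₁` is the constant of `H1` and the chain has `N + 1` points. -/
def H2 (Ω : TopologicalSpace.Opens (Rn n)) (C₁ : ℝ) (N : ℕ) : Prop :=
  ∀ r : ℝ, 0 < r → ∀ X ∈ Ω, ∀ Y ∈ Ω, r < δ Ω X → r < δ Ω Y → dist X Y ≤ 7 * C₁ * r →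
    ∃ Z : ℕ → Rn n, Z 0 = X ∧ Z N = Y ∧ (∀ i ≤ N, Z i ∈ Ω) ∧
      ∀ i < N, dist (Z i) (Z (i + 1)) < 1 / 2 * δ Ω (Z i)

/-- `μ` is a doubling measure with support `Γ`. -/
def H3 (Ω : TopologicalSpace.Opens (Rn n)) (μ : Measure (Rn n)) (C₃ : ℝ≥0) : Prop :=
  μ.support = bdry Ω ∧ ∀ x ∈ bdry Ω, ∀ r : ℝ, 0 < r → μ (ball x (2 * r)) ≤ C₃ * μ (ball x r)

/-- On `Ω`, the measure `m` has a positive locally integrable density, and it is doubling. -/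
def H4 (Ω : TopologicalSpace.Opens (Rn n)) (m : Measure (Rn n)) (C₄ : ℝ≥0) : Prop :=
  (∃ w : Rn n → ℝ, LocallyIntegrableOn w Ω volume ∧
    (∀ᵐ X ∂volume.restrict (Ω : Set (Rn n)), 0 < w X) ∧
    ∀ A : Set (Rn n), MeasurableSet A → A ⊆ Ω → m A = ∫⁻ X in A, ENNReal.ofReal (w X)) ∧
  ∀ X ∈ closure (Ω : Set (Rn n)), ∀ r : ℝ, 0 < r →
    m (ball X (2 * r) ∩ Ω) ≤ C₄ * m (ball X r ∩ Ω)

/-- Compared growth of `m` and `μ`, with `ε = 1 / C₅`. -/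
def H5 (Ω : TopologicalSpace.Opens (Rn n)) (m μ : Measure (Rn n)) (C₅ : ℝ) : Prop :=
  0 < C₅ ∧ ∀ x ∈ bdry Ω, ∀ s r : ℝ, 0 < s → s < r →
    rho Ω m μ x r / rho Ω m μ x s ≤ C₅ * (r / s) ^ (1 - C₅⁻¹)

/-- Uniqueness of limit gradients, and the weak Poincaré inequality in interior balls. -/
def H6 (Ω : TopologicalSpace.Opens (Rn n)) (m : Measure (Rn n)) (C₆ : ℝ) : Prop :=
  (∀ D : Set (Rn n), IsOpen D → IsCompact (closure D) → closure D ⊆ Ω →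
    ∀ (u : ℕ → Rn n → ℝ) (v : Rn n → Rn n), (∀ i, SmoothUpTo D (u i)) →
      MemLp v 2 (m.restrict D) →
      Tendsto (fun i => eLpNorm (u i) 1 (m.restrict D)) atTop (𝓝 0) →
      Tendsto (fun i => eLpNorm (fun X => gradient (u i) X - v X) 2 (m.restrict D)) atTop (𝓝 0) →
      v =ᵐ[m.restrict D] 0) ∧
  ∀ (X : Rn n) (r : ℝ), 0 < r → ball X (2 * r) ⊆ Ω → ∀ u : Rn n → ℝ, SmoothUpTo (ball X r) u →
    ⨍ Z in ball X r, |u Z - ⨍ Y in ball X r, u Y ∂m| ∂m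
      ≤ C₆ * r * √(⨍ Z in ball X r, ‖gradient u Z‖ ^ 2 ∂m)

/-! ### The space `W` -/

/-- `u` belongs to `W` with gradient `v`: `u ∈ L¹_loc(Ω,m)`, `v ∈ L²(Ω,m)`, and there are
`φᵢ ∈ C^∞(closure Ω)` with `∇φᵢ ∈ L²(Ω,m)`, with `φᵢ → u` in `L¹(B,m)` for each ball `B` such that
`2B ⊆ Ω`, and with `∇φᵢ → v` in `L²(Ω,m)`. -/
def IsWGrad (Ω : TopologicalSpace.Opens (Rn n)) (m : Measure (Rn n))
    (u : Rn n → ℝ) (v : Rn n → Rn n) : Prop :=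
  LocallyIntegrableOn u Ω m ∧ MemLp v 2 (m.restrict Ω) ∧
  ∃ φ : ℕ → Rn n → ℝ, (∀ i, SmoothUpTo Ω (φ i)) ∧
    (∀ i, MemLp (gradient (φ i)) 2 (m.restrict Ω)) ∧
    (∀ (X : Rn n) (r : ℝ), 0 < r → ball X (2 * r) ⊆ Ω →
      Tendsto (fun i => eLpNorm (fun Z => φ i Z - u Z) 1 (m.restrict (ball X r))) atTop (𝓝 0)) ∧
    Tendsto (fun i => eLpNorm (fun Z => gradient (φ i) Z - v Z) 2 (m.restrict Ω)) atTop (𝓝 0)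

variable {Ω : TopologicalSpace.Opens (Rn n)} {m μ : Measure (Rn n)}

lemma SmoothUpTo.add {u v : Rn n → ℝ} (hu : SmoothUpTo (Ω : Set (Rn n)) u)
    (hv : SmoothUpTo (Ω : Set (Rn n)) v) : SmoothUpTo (Ω : Set (Rn n)) (u + v) := by
  refine ⟨hu.1.add hv.1, fun k => ?_⟩
  obtain ⟨g, hg, hg'⟩ := hu.2 k
  obtain ⟨h, hh, hh'⟩ := hv.2 k
  refine ⟨g + h, hg.add hh, fun x hx => ?_⟩
  have h1 := (hu.1.contDiffAt (Ω.isOpen.mem_nhds hx)).of_le (m := (k : WithTop ℕ∞))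
    (by exact_mod_cast le_top)
  have h2 := (hv.1.contDiffAt (Ω.isOpen.mem_nhds hx)).of_le (m := (k : WithTop ℕ∞))
    (by exact_mod_cast le_top)
  rw [iteratedFDeriv_add_apply h1 h2, hg' hx, hh' hx, Pi.add_apply]

lemma SmoothUpTo.smul {u : Rn n → ℝ} (c : ℝ) (hu : SmoothUpTo (Ω : Set (Rn n)) u) :
    SmoothUpTo (Ω : Set (Rn n)) (c • u) := by
  refine ⟨hu.1.const_smul c, fun k => ?_⟩
  obtain ⟨g, hg, hg'⟩ := hu.2 k
  refine ⟨c • g, hg.const_smul c, fun x hx => ?_⟩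
  have h1 := (hu.1.contDiffAt (Ω.isOpen.mem_nhds hx)).of_le (m := (k : WithTop ℕ∞))
    (by exact_mod_cast le_top)
  rw [iteratedFDeriv_const_smul_apply h1, hg' hx, Pi.smul_apply]

lemma SmoothUpTo.differentiableAt {u : Rn n → ℝ} (hu : SmoothUpTo (Ω : Set (Rn n)) u)
    {x : Rn n} (hx : x ∈ Ω) : DifferentiableAt ℝ u x :=
  (hu.1.contDiffAt (Ω.isOpen.mem_nhds hx)).differentiableAt (by simp)

lemma SmoothUpTo.aesm {u : Rn n → ℝ} (hu : SmoothUpTo (Ω : Set (Rn n)) u)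
    {B : Set (Rn n)} (hB : MeasurableSet B) (h : B ⊆ Ω) :
    AEStronglyMeasurable u (m.restrict B) :=
  (hu.1.continuousOn.mono h).aestronglyMeasurable hB

lemma ball_sub_double (X : Rn n) {r : ℝ} (hr : 0 < r) (h : ball X (2 * r) ⊆ Ω) :
    ball X r ⊆ Ω := (ball_subset_ball (by linarith)).trans h

lemma LocallyIntegrableOn.aesm {u : Rn n → ℝ}
    (hu : LocallyIntegrableOn u Ω m) {B : Set (Rn n)} (h : B ⊆ Ω) :
    AEStronglyMeasurable u (m.restrict B) :=
  hu.aestronglyMeasurable.mono_measure (Measure.restrict_mono_set m h)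

lemma IsWGrad.congr {u u' : Rn n → ℝ} {v : Rn n → Rn n} (h : IsWGrad Ω m u v)
    (huu : u =ᵐ[m.restrict Ω] u') : IsWGrad Ω m u' v := by
  obtain ⟨h1, h2, φ, h3, h4, h5, h6⟩ := h
  refine ⟨LocallyIntegrableOn.congr huu h1, h2, φ, h3, h4, fun X r hr hB => ?_, h6⟩
  refine (h5 X r hr hB).congr fun i => eLpNorm_congr_ae ?_
  have := ae_mono (Measure.restrict_mono_set m (ball_sub_double X hr hB)) huu
  filter_upwards [this] with z hz
  rw [hz]

lemma tendsto_eLpNorm_add {ι F : Type*} [NormedAddCommGroup F] {l : Filter ι}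
    {ν : Measure (Rn n)} {p : ℝ≥0∞}
    (hp : 1 ≤ p) {f g k : ι → Rn n → F} (hf : ∀ i, AEStronglyMeasurable (f i) ν)
    (hg : ∀ i, AEStronglyMeasurable (g i) ν) (hk : ∀ i, k i =ᵐ[ν] f i + g i)
    (tf : Tendsto (fun i => eLpNorm (f i) p ν) l (𝓝 0))
    (tg : Tendsto (fun i => eLpNorm (g i) p ν) l (𝓝 0)) :
    Tendsto (fun i => eLpNorm (k i) p ν) l (𝓝 0) := by
  refine tendsto_of_tendsto_of_tendsto_of_le_of_le tendsto_const_nhds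
    (by simpa using tf.add tg) (fun _ => zero_le) fun i => ?_
  rw [eLpNorm_congr_ae (hk i)]
  exact eLpNorm_add_le (hf i) (hg i) hp

lemma tendsto_eLpNorm_smul {ι F : Type*} [NormedAddCommGroup F] [NormedSpace ℝ F] {l : Filter ι}
    {ν : Measure (Rn n)} {p : ℝ≥0∞} (c : ℝ) {f k : ι → Rn n → F} (hk : ∀ i, k i =ᵐ[ν] c • f i)
    (tf : Tendsto (fun i => eLpNorm (f i) p ν) l (𝓝 0)) :
    Tendsto (fun i => eLpNorm (k i) p ν) l (𝓝 0) := by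
  have : ∀ i, eLpNorm (k i) p ν = ‖c‖ₑ * eLpNorm (f i) p ν := fun i => by
    rw [eLpNorm_congr_ae (hk i), eLpNorm_const_smul]
  simp_rw [this]
  simpa using ENNReal.Tendsto.const_mul tf (Or.inr (by simp))

lemma gradient_add_on {φ ψ : Rn n → ℝ} (hφ : SmoothUpTo (Ω : Set (Rn n)) φ)
    (hψ : SmoothUpTo (Ω : Set (Rn n)) ψ) :
    gradient (φ + ψ) =ᵐ[m.restrict Ω] gradient φ + gradient ψ := by
  filter_upwards [ae_restrict_mem Ω.isOpen.measurableSet] with z hz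
  simp only [gradient, Pi.add_apply]
  rw [fderiv_add (hφ.differentiableAt hz) (hψ.differentiableAt hz), map_add]

lemma gradient_smul_on (c : ℝ) {φ : Rn n → ℝ} (hφ : SmoothUpTo (Ω : Set (Rn n)) φ) :
    gradient (c • φ) =ᵐ[m.restrict Ω] c • gradient φ := by
  filter_upwards [ae_restrict_mem Ω.isOpen.measurableSet] with z hz
  simp only [gradient, Pi.smul_apply]
  rw [fderiv_const_smul (hφ.differentiableAt hz)]
  simp

lemma IsWGrad.add {u u' : Rn n → ℝ} {v v' : Rn n → Rn n} (h : IsWGrad Ω m u v)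
    (h' : IsWGrad Ω m u' v') : IsWGrad Ω m (u + u') (v + v') := by
  obtain ⟨h1, h2, φ, h3, h4, h5, h6⟩ := h
  obtain ⟨k1, k2, ψ, k3, k4, k5, k6⟩ := h'
  refine ⟨h1.add k1, h2.add k2, fun i => φ i + ψ i, fun i => (h3 i).add (k3 i), fun i => ?_,
    fun X r hr hB => ?_, ?_⟩
  · exact ((h4 i).add (k4 i)).ae_eq (gradient_add_on (h3 i) (k3 i)).symm
  · have hs := ball_sub_double X hr hB
    refine tendsto_eLpNorm_add le_rfl
      (fun i => ((h3 i).aesm measurableSet_ball hs).sub (LocallyIntegrableOn.aesm h1 hs))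
      (fun i => ((k3 i).aesm measurableSet_ball hs).sub (LocallyIntegrableOn.aesm k1 hs))
      (fun i => ?_) (h5 X r hr hB) (k5 X r hr hB)
    filter_upwards with z
    simp only [Pi.add_apply, Pi.sub_apply]; ring
  · refine tendsto_eLpNorm_add one_le_two
      (fun i => ((h4 i).sub h2).aestronglyMeasurable)
      (fun i => ((k4 i).sub k2).aestronglyMeasurable) (fun i => ?_) h6 k6
    filter_upwards [gradient_add_on (m := m) (h3 i) (k3 i)] with z hz
    simp only [Pi.add_apply, Pi.sub_apply] at hz ⊢
    rw [hz]; abel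

lemma IsWGrad.smul (c : ℝ) {u : Rn n → ℝ} {v : Rn n → Rn n} (h : IsWGrad Ω m u v) :
    IsWGrad Ω m (c • u) (c • v) := by
  obtain ⟨h1, h2, φ, h3, h4, h5, h6⟩ := h
  refine ⟨h1.smul c, h2.const_smul c, fun i => c • φ i, fun i => (h3 i).smul c, fun i => ?_,
    fun X r hr hB => ?_, ?_⟩
  · exact ((h4 i).const_smul c).ae_eq (gradient_smul_on c (h3 i)).symm
  · refine tendsto_eLpNorm_smul c (fun i => ?_) (h5 X r hr hB)
    filter_upwards with z
    simp only [Pi.smul_apply, smul_eq_mul]; ring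
  · refine tendsto_eLpNorm_smul c (fun i => ?_) h6
    filter_upwards [gradient_smul_on (m := m) c (h3 i)] with z hz
    simp only [Pi.smul_apply] at hz ⊢
    rw [hz, smul_sub]

lemma IsWGrad.zero : IsWGrad Ω m (0 : Rn n → ℝ) 0 := by
  have hg : gradient (0 : Rn n → ℝ) = 0 := by
    funext x
    have := gradient_const x (0 : ℝ)
    simpa using this
  refine ⟨locallyIntegrableOn_zero, MemLp.zero, fun _ => 0, fun i => ⟨contDiffOn_const, fun k =>
    ⟨0, continuousOn_const, fun x _ => by simp⟩⟩, fun i => ?_, fun X r _ _ => ?_, ?_⟩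
  · rw [hg]; exact MemLp.zero
  · simp
  · simp [hg]

variable (Ω m) in
/-- The space `W`, as a space of `m`-a.e. classes of functions on `Ω`. -/
def W : Submodule ℝ (Rn n →ₘ[m.restrict Ω] ℝ) where
  carrier := {u | ∃ v, IsWGrad Ω m u v}
  zero_mem' := ⟨0, IsWGrad.zero.congr AEEqFun.coeFn_zero.symm⟩
  add_mem' := by
    rintro a b ⟨v, hv⟩ ⟨v', hv'⟩
    exact ⟨v + v', (hv.add hv').congr (AEEqFun.coeFn_add a b).symm⟩
  smul_mem' := by
    rintro c a ⟨v, hv⟩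
    exact ⟨c • v, (hv.smul c).congr (AEEqFun.coeFn_smul c a).symm⟩

/-- The gradient `∇u ∈ L²(Ω,m)` of `u ∈ W`: the field `v` of the definition of `W`, which is unique
up to `m`-null sets as soon as the first part of `H6` holds. -/
noncomputable def wGrad (u : W Ω m) : Rn n → Rn n := u.2.choose

/-- The semi-norm `‖u‖_W = ‖∇u‖_{L²(Ω,m)}`. -/
noncomputable def wNorm (u : W Ω m) : ℝ := √(∫ Z in Ω, ‖wGrad u Z‖ ^ 2 ∂m)

/-! ### The space `H` -/

/-- The kernel `ρ(x,|x-y|)² / m(B(x,|x-y|) ∩ Ω)`, with value `0` for `x = y`. -/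
noncomputable def hKer (Ω : TopologicalSpace.Opens (Rn n)) (m μ : Measure (Rn n))
    (x y : Rn n) : ℝ := rho Ω m μ x (dist x y) ^ 2 / mBall Ω m x (dist x y)

/-- `∫_Γ ∫_Γ ρ(x,|x-y|)² |g(x)-g(y)|² / m(B(x,|x-y|) ∩ Ω) dμ(y) dμ(x)`. -/
noncomputable def hEnergy (Ω : TopologicalSpace.Opens (Rn n)) (m μ : Measure (Rn n))
    (g : Rn n → ℝ) : ℝ≥0∞ :=
  ∫⁻ x in bdry Ω, ∫⁻ y in bdry Ω, ENNReal.ofReal (hKer Ω m μ x y * |g x - g y| ^ 2) ∂μ ∂μ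

lemma measurable_measure_ball (ν : Measure (Rn n)) :
    Measurable (fun p : Rn n × ℝ => ν (ball p.1 p.2)) := by
  refine LowerSemicontinuous.measurable ?_
  rintro ⟨x, r⟩ a ha
  have hU : ball x r = ⋃ k : ℕ, ball x (r - 1 / ((k : ℝ) + 1)) := by
    ext z
    simp only [mem_ball, Set.mem_iUnion]
    constructor
    · intro h
      obtain ⟨k, hk⟩ := exists_nat_one_div_lt (sub_pos.2 h)
      exact ⟨k, by linarith⟩
    · rintro ⟨k, hk⟩
      have : (0 : ℝ) < 1 / ((k : ℝ) + 1) := by positivity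
      linarith
  have hmono : Monotone fun k : ℕ => ball x (r - 1 / ((k : ℝ) + 1)) := fun i j hij =>
    ball_subset_ball (sub_le_sub_left (Nat.one_div_le_one_div hij) r)
  have ha' : a < ν (ball x r) := ha
  rw [hU, hmono.measure_iUnion, lt_iSup_iff] at ha'
  obtain ⟨k, hk⟩ := ha'
  set s := r - 1 / ((k : ℝ) + 1) with hs
  have hpos : (0 : ℝ) < 1 / ((k : ℝ) + 1) := by positivity
  have hev : ∀ᶠ p : Rn n × ℝ in 𝓝 (x, r), dist x p.1 + s < p.2 :=
    (isOpen_lt (by fun_prop) (by fun_prop)).mem_nhds (by simp; linarith)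
  filter_upwards [hev] with p hp
  refine hk.trans_le (measure_mono fun z hz => ?_)
  have := dist_triangle z x p.1
  simp only [mem_ball] at hz ⊢
  linarith

lemma measurable_hKer (Ω : TopologicalSpace.Opens (Rn n)) (m μ : Measure (Rn n)) :
    Measurable fun p : Rn n × Rn n => hKer Ω m μ p.1 p.2 := by
  have hd : Measurable fun p : Rn n × Rn n => (p.1, dist p.1 p.2) := by fun_prop
  have h1 : Measurable fun p : Rn n × Rn n => mBall Ω m p.1 (dist p.1 p.2) := by
    have := ((measurable_measure_ball (m.restrict Ω)).comp hd).ennreal_toReal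
    have he : (fun p : Rn n × Rn n => mBall Ω m p.1 (dist p.1 p.2)) = fun p : Rn n × Rn n =>
        ((m.restrict Ω) (ball p.1 (dist p.1 p.2))).toReal := funext fun p => by
      simp only [mBall, Measure.real, Measure.restrict_apply measurableSet_ball]
    rw [he]
    exact this
  have h2 : Measurable fun p : Rn n × Rn n => μ.real (ball p.1 (dist p.1 p.2)) :=
    ((measurable_measure_ball μ).comp hd).ennreal_toReal
  have h3 : Measurable fun p : Rn n × Rn n => dist p.1 p.2 := by fun_prop
  unfold hKer rho
  exact ((h1.div (h3.mul h2)).pow_const 2).div h1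

lemma hKer_nonneg (x y : Rn n) : 0 ≤ hKer Ω m μ x y := by
  unfold hKer mBall; positivity

lemma hEnergy_congr {g h : Rn n → ℝ} (hgh : g =ᵐ[μ] h) : hEnergy Ω m μ g = hEnergy Ω m μ h := by
  have hr := ae_restrict_of_ae (s := bdry Ω) hgh
  refine lintegral_congr_ae ?_
  filter_upwards [hr] with x hx
  refine lintegral_congr_ae ?_
  filter_upwards [hr] with y hy
  rw [hx, hy]

lemma hEnergy_add_le [SFinite μ] {g h : Rn n → ℝ} (hg : Measurable g) :
    hEnergy Ω m μ (g + h) ≤ 2 * hEnergy Ω m μ g + 2 * hEnergy Ω m μ h := by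
  have hk := measurable_hKer Ω m μ
  have key : ∀ f : Rn n → ℝ, Measurable f → Measurable fun p : Rn n × Rn n =>
      ENNReal.ofReal (hKer Ω m μ p.1 p.2 * |f p.1 - f p.2| ^ 2) := fun f hf => by
    refine (hk.mul (Measurable.pow_const ?_ 2)).ennreal_ofReal
    have : Measurable fun p : Rn n × Rn n => f p.1 - f p.2 :=
      (hf.comp measurable_fst).sub (hf.comp measurable_snd)
    simpa [Real.norm_eq_abs] using this.norm
  have inner : ∀ x, ∫⁻ y in bdry Ω,
        ENNReal.ofReal (hKer Ω m μ x y * |(g + h) x - (g + h) y| ^ 2) ∂μ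
      ≤ 2 * ∫⁻ y in bdry Ω, ENNReal.ofReal (hKer Ω m μ x y * |g x - g y| ^ 2) ∂μ
        + 2 * ∫⁻ y in bdry Ω, ENNReal.ofReal (hKer Ω m μ x y * |h x - h y| ^ 2) ∂μ := fun x => by
    have m1 := (key g hg).comp (measurable_prodMk_left (x := x))
    rw [← lintegral_const_mul' _ _ (by simp), ← lintegral_const_mul' _ _ (by simp),
      ← lintegral_add_left (by exact m1.const_mul 2)]
    refine lintegral_mono fun y => ?_
    have h0 := hKer_nonneg (Ω := Ω) (m := m) (μ := μ) x y
    rw [show (2 : ℝ≥0∞) = ENNReal.ofReal 2 by simp, ← ENNReal.ofReal_mul (by norm_num),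
      ← ENNReal.ofReal_mul (by norm_num), ← ENNReal.ofReal_add (by positivity) (by positivity)]
    refine ENNReal.ofReal_le_ofReal ?_
    simp only [Pi.add_apply, sq_abs]
    nlinarith [mul_nonneg h0 (sq_nonneg ((g x - g y) - (h x - h y)))]
  unfold hEnergy
  rw [← lintegral_const_mul' _ _ (by simp), ← lintegral_const_mul' _ _ (by simp),
    ← lintegral_add_left]
  · exact lintegral_mono inner
  · exact (Measurable.lintegral_prod_right' (key g hg)).const_mul 2

lemma hEnergy_smul (c : ℝ) (g : Rn n → ℝ) :
    hEnergy Ω m μ (c • g) = ENNReal.ofReal (c ^ 2) * hEnergy Ω m μ g := by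
  unfold hEnergy
  rw [← lintegral_const_mul' _ _ (by simp)]
  refine lintegral_congr fun x => ?_
  rw [← lintegral_const_mul' _ _ (by simp)]
  refine lintegral_congr fun y => ?_
  rw [← ENNReal.ofReal_mul (by positivity)]
  congr 1
  simp only [Pi.smul_apply, smul_eq_mul, sq_abs]
  ring

variable (Ω m μ) in
/-- The space `H`, as a space of `μ`-a.e. classes of functions. -/
def H [SFinite μ] : Submodule ℝ (Rn n →ₘ[μ] ℝ) where
  carrier := {g | hEnergy Ω m μ g < ⊤}
  zero_mem' := by
    rw [Set.mem_ofPred_eq, hEnergy_congr AEEqFun.coeFn_zero]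
    simp [hEnergy]
  add_mem' := by
    intro a b ha hb
    rw [Set.mem_ofPred_eq] at *
    rw [hEnergy_congr (AEEqFun.coeFn_add a b)]
    exact (hEnergy_add_le a.measurable).trans_lt
      (ENNReal.add_lt_top.2 ⟨ENNReal.mul_lt_top (by simp) ha, ENNReal.mul_lt_top (by simp) hb⟩)
  smul_mem' := by
    intro c a ha
    rw [Set.mem_ofPred_eq] at *
    rw [hEnergy_congr (AEEqFun.coeFn_smul c a), hEnergy_smul]
    exact ENNReal.mul_lt_top (by simp) ha

/-- The semi-norm of `H`. -/
noncomputable def hNorm [SFinite μ] (g : H Ω m μ) : ℝ :=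
  √(hEnergy Ω m μ (g : Rn n →ₘ[μ] ℝ)).toReal

/-! ### Access cones -/

/-- A system of dyadic pseudocubes on `Γ`; `cubes k` is the collection `𝔻ₖ`. -/
structure DyadicSystem (Γ : Set (Rn n)) where
  cubes : ℤ → Set (Set (Rn n))
  measurable : ∀ k, ∀ Q ∈ cubes k, MeasurableSet Q
  cover : ∀ k, ⋃₀ cubes k = Γ
  nested : ∀ k l, k ≤ l → ∀ P ∈ cubes l, ∀ Q ∈ cubes k, P ⊆ Q ∨ Disjoint P Q
  ancestor : ∀ k l, l < k → ∀ Q ∈ cubes k, ∃! P, P ∈ cubes l ∧ Q ⊆ P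
  diam_le : ∀ k, ∀ Q ∈ cubes k, ∀ x ∈ Q, ∀ y ∈ Q, dist x y ≤ (2 : ℝ) ^ (-k)
  a₀ : ℝ
  a₀_pos : 0 < a₀
  inner_ball : ∀ k, ∀ Q ∈ cubes k, ∃ z ∈ Γ, ball z (a₀ * (2 : ℝ) ^ (-k)) ∩ Γ ⊆ Q

/-- `dist(A,B)` for nonempty sets. -/
noncomputable def setDist (A B : Set (Rn n)) : ℝ := sInf (Set.image2 dist A B)

/-- `t I`, where `I = ∏ [κᵢ 2⁻ʲ, (κᵢ + 1) 2⁻ʲ]` is a dyadic cube and `t I` has the same center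
and `t` times the side length. -/
def dyadicCube (t : ℝ) (j : ℤ) (κ : Fin n → ℤ) : Set (Rn n) :=
  {p | ∀ i, |p i - ((κ i : ℝ) + 1 / 2) * (2 : ℝ) ^ (-j)| ≤ t / 2 * (2 : ℝ) ^ (-j)}

/-- `4 diam I ≤ dist(4I, Γ)`. -/
def FarFromBdry (Ω : TopologicalSpace.Opens (Rn n)) (j : ℤ) (κ : Fin n → ℤ) : Prop :=
  4 * diam (dyadicCube 1 j κ) ≤ setDist (dyadicCube 4 j κ) (bdry Ω)

/-- `I ∈ 𝒲`: the dyadic cube `I ⊆ Ω` satisfies `FarFromBdry`, and its parent does not. -/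
def IsWhitney (Ω : TopologicalSpace.Opens (Rn n)) (j : ℤ) (κ : Fin n → ℤ) : Prop :=
  dyadicCube 1 j κ ⊆ Ω ∧ FarFromBdry Ω j κ ∧ ¬ FarFromBdry Ω (j - 1) fun i => κ i / 2

/-- `U_Q`, for a pseudocube `Q` of generation `k` and length `ℓ(Q) = 2⁻ᵏ`: the union of the
`I ∈ 𝒲` with `ℓ(Q) / C_a ≤ ℓ(I)` and `dist(I,Q) ≤ 2 ℓ(Q)`. -/
def whitneyRegion (Ω : TopologicalSpace.Opens (Rn n)) (Ca : ℝ) (k : ℤ) (Q : Set (Rn n)) :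
    Set (Rn n) :=
  {X | ∃ (j : ℤ) (κ : Fin n → ℤ), IsWhitney Ω j κ ∧ Ca⁻¹ * (2 : ℝ) ^ (-k) ≤ (2 : ℝ) ^ (-j) ∧
    setDist (dyadicCube 1 j κ) Q ≤ 2 * (2 : ℝ) ^ (-k) ∧ X ∈ dyadicCube 1 j κ}

/-- The access cone `γ(x)`: the union of the `U_Q` over the pseudocubes `Q ∋ x`. -/
def cone (Ω : TopologicalSpace.Opens (Rn n)) (𝔻 : DyadicSystem (bdry Ω)) (Ca : ℝ) (x : Rn n) :
    Set (Rn n) :=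
  {X | ∃ (k : ℤ) (Q : Set (Rn n)), Q ∈ 𝔻.cubes k ∧ x ∈ Q ∧ X ∈ whitneyRegion Ω Ca k Q}

/-- The filter `X ∈ γ(x)`, `δ(X) → 0`. -/
noncomputable def coneFilter (Ω : TopologicalSpace.Opens (Rn n)) (𝔻 : DyadicSystem (bdry Ω))
    (Ca : ℝ) (x : Rn n) : Filter (Rn n) :=
  comap (δ Ω) (𝓝 0) ⊓ 𝓟 (cone Ω 𝔻 Ca x)

end MixedDim

namespace MixedDim

variable {n : ℕ} {Ω : TopologicalSpace.Opens (Rn n)} {m μ : Measure (Rn n)}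

/-! ### The distance to the boundary -/

/-! The trace at `x` is the limit, as `k → ∞`, of averages of `u` over Whitney balls centered at
corkscrew points of `B(x,2⁻ᵏ)`. By the Poincaré inequality and Harnack chains, two such averages at
scale `r = 2⁻ᵏ` differ by at most a constant times `r (E / m(B(x,r) ∩ Ω))^{1/2}`, where `E` is the
energy of `u` in the set of points whose distances to `x` and to `Γ` are comparable to `r`
(`shadow`). Multiplying and dividing by `μ(B(x,r))` turns this into `(r/ρ(x,r))^{1/2} Sₖ(x)^{1/2}`,
where `Sₖ` is `shadowEnergy` (`oscBound_eq`).

Two facts drive the proof. A point of `Ω` lies in shadows of boundedly many scales, so Tonelli and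
the doubling of `μ` give `∑ₖ ∫ Sₖ dμ ≤ C ‖u‖_W²` (`H3.exists_tsum_shadowEnergy_le`). And (H5) makes
`r/ρ(x,r)` decay geometrically over the dyadic scales (`H5.scaleRatio_le`). So the increments are
summable for a.e. `x`, and the limit exists. A point of the cone is nontangential
(`cone_nontangential`) and is joined by a chain of bounded length to a corkscrew point of comparable
scale, so averages and mean oscillations converge along the cone as well.

For the energy, when `|x-y|` is about `2⁻ᵏ`, pass from the trace at `x` to the trace at `y` through
averages at that scale. A weighted Cauchy–Schwarz inequality (`ofReal_sq_sub_limit_le`) bounds the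
squares by `r/ρ` times a tail `∑ᵢ σⁱ Sₖ₊ᵢ` with `σ < 1`. The kernel of `H` times `r/ρ` is at most a
multiple of `1/μ(B(x,2⁻ᵏ))` (`hKer_mul_scaleRatio_le`); integrating over the annulus and summing
over `k` leads back to `∑ₖ ∫ Sₖ dμ`.

The corkscrew points are chosen independently of `u`, which gives linearity, and from a countable
set, which gives measurability. -/

lemma delta_le_dist {x : Rn n} (hx : x ∈ bdry Ω) (X : Rn n) : δ Ω X ≤ dist X x :=
  infDist_le_dist_of_mem hx

lemma delta_le_add (X Y : Rn n) : δ Ω X ≤ δ Ω Y + dist X Y := infDist_le_infDist_add_dist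

lemma continuous_delta : Continuous (δ Ω) := continuous_infDist_pt _

lemma bdry_subset_closure {x : Rn n} (hx : x ∈ bdry Ω) : x ∈ closure (Ω : Set (Rn n)) :=
  frontier_subset_closure hx

lemma notMem_bdry {X : Rn n} (hX : X ∈ Ω) : X ∉ bdry Ω := by
  rw [bdry, Ω.isOpen.frontier_eq]
  exact fun h => h.2 hX

lemma delta_pos (hΓ : (bdry Ω).Nonempty) {X : Rn n} (hX : X ∈ Ω) : 0 < δ Ω X :=
  (isClosed_frontier.notMem_iff_infDist_pos hΓ).1 (notMem_bdry hX)

/-- The ball is connected and misses `Γ`, so it is covered by the disjoint open sets `Ω` and the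
complement of its closure; it meets the first. If `Γ` is empty, `infDist` makes the radius `0` and
the ball empty. -/
lemma ball_delta_subset {X : Rn n} (hX : X ∈ Ω) : ball X (δ Ω X) ⊆ Ω := by
  intro Y hY
  by_contra hYΩ
  have hc : IsPreconnected (ball X (δ Ω X)) := (convex_ball X _).isPreconnected
  have hpos : 0 < δ Ω X := (dist_nonneg).trans_lt hY
  have hcov : ball X (δ Ω X) ⊆ (Ω : Set (Rn n)) ∪ (closure (Ω : Set (Rn n)))ᶜ := by
    intro Z hZ
    by_contra h
    rw [Set.mem_union, not_or, Set.mem_compl_iff, not_not] at h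
    have hZb : Z ∈ bdry Ω := by
      rw [bdry, Ω.isOpen.frontier_eq]
      exact ⟨h.2, h.1⟩
    have := delta_le_dist hZb X
    rw [mem_ball, dist_comm] at hZ
    linarith
  have hY' : Y ∈ (closure (Ω : Set (Rn n)))ᶜ := (hcov hY).resolve_left hYΩ
  obtain ⟨Z, -, h1, h2⟩ := hc _ _ Ω.isOpen isClosed_closure.isOpen_compl hcov
    ⟨X, mem_ball_self hpos, hX⟩ ⟨Y, hY, hY'⟩
  exact h2 (subset_closure h1)

lemma ball_half_delta_subset {X : Rn n} (hX : X ∈ Ω) : ball X (2 * (δ Ω X / 2)) ⊆ Ω := by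
  rw [mul_div_cancel₀ _ two_ne_zero]
  exact ball_delta_subset hX

lemma mem_of_dist_lt_delta {X Y : Rn n} (hX : X ∈ Ω) (h : dist X Y < δ Ω X) : Y ∈ Ω :=
  ball_delta_subset hX (by rwa [mem_ball, dist_comm])

/-! ### The measures of balls -/

lemma mBall_eq_of_subset {X : Rn n} {r : ℝ} (h : ball X r ⊆ Ω) :
    mBall Ω m X r = m.real (ball X r) := by
  rw [mBall, Set.inter_eq_left.2 h]

lemma H4.measure_ball_two_pow_le {C₄ : ℝ≥0} (h4 : H4 Ω m C₄) {X : Rn n}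
    (hX : X ∈ closure (Ω : Set (Rn n))) {r : ℝ} (hr : 0 < r) (p : ℕ) :
    m (ball X (2 ^ p * r) ∩ Ω) ≤ (C₄ : ℝ≥0∞) ^ p * m (ball X r ∩ Ω) := by
  induction p with
  | zero => simp
  | succ p ih =>
    calc m (ball X (2 ^ (p + 1) * r) ∩ Ω) = m (ball X (2 * (2 ^ p * r)) ∩ Ω) := by
          rw [pow_succ', mul_assoc]
      _ ≤ C₄ * m (ball X (2 ^ p * r) ∩ Ω) := h4.2 X hX _ (by positivity)
      _ ≤ C₄ * ((C₄ : ℝ≥0∞) ^ p * m (ball X r ∩ Ω)) := by gcongr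
      _ = _ := by rw [pow_succ', mul_assoc]

/-- Local integrability of the density gives one small ball of finite measure around a point of `Ω`,
and doubling enlarges it to any radius. A point of the closure is handled by recentering at a nearby
point of `Ω`. -/
lemma H4.measure_ball_lt_top {C₄ : ℝ≥0} (h4 : H4 Ω m C₄) {X : Rn n}
    (hX : X ∈ closure (Ω : Set (Rn n))) (r : ℝ) : m (ball X r ∩ Ω) < ⊤ := by
  have key : ∀ Y ∈ Ω, ∀ r : ℝ, m (ball Y r ∩ Ω) < ⊤ := by
    intro Y hY r
    obtain ⟨w, hw, -, hmw⟩ := h4.1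
    obtain ⟨s, hs, hws⟩ := hw Y hY
    rw [Ω.isOpen.nhdsWithin_eq hY] at hs
    obtain ⟨t, ht, hts⟩ := Metric.mem_nhds_iff.1 (Filter.inter_mem hs (Ω.isOpen.mem_nhds hY))
    have hfin : m (ball Y t ∩ Ω) < ⊤ := by
      rw [Set.inter_eq_left.2 (hts.trans Set.inter_subset_right),
        hmw _ measurableSet_ball (hts.trans Set.inter_subset_right)]
      exact (hws.mono_set (hts.trans Set.inter_subset_left)).lintegral_lt_top
    obtain ⟨p, hp⟩ := pow_unbounded_of_one_lt (r / t) one_lt_two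
    refine lt_of_le_of_lt (measure_mono ?_) ((h4.measure_ball_two_pow_le (subset_closure hY)
      ht p).trans_lt (ENNReal.mul_lt_top (by finiteness) hfin))
    gcongr
    rw [div_lt_iff₀ ht] at hp
    exact hp.le
  obtain ⟨Y, hY, hXY⟩ := Metric.mem_closure_iff.1 hX 1 one_pos
  refine (measure_mono ?_).trans_lt (key Y hY (r + 1))
  gcongr
  exact ball_subset_ball' (by linarith)

lemma H4.measure_ball_pos {C₄ : ℝ≥0} (h4 : H4 Ω m C₄) {X : Rn n}
    (hX : X ∈ closure (Ω : Set (Rn n))) {r : ℝ} (hr : 0 < r) : 0 < m (ball X r ∩ Ω) := by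
  obtain ⟨w, hw, hw0, hmw⟩ := h4.1
  have hmeas : MeasurableSet (ball X r ∩ (Ω : Set (Rn n))) :=
    measurableSet_ball.inter Ω.isOpen.measurableSet
  rw [hmw _ hmeas Set.inter_subset_right, pos_iff_ne_zero]
  intro h0
  have hwm : AEMeasurable w (volume.restrict (ball X r ∩ (Ω : Set (Rn n)))) :=
    (hw.aestronglyMeasurable.mono_measure
      (Measure.restrict_mono_set _ Set.inter_subset_right)).aemeasurable
  rw [lintegral_eq_zero_iff' hwm.ennreal_ofReal] at h0
  have hw0' := ae_mono (Measure.restrict_mono_set volume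
    (Set.inter_subset_right : ball X r ∩ (Ω : Set (Rn n)) ⊆ Ω)) hw0
  have hf : ∀ᵐ Z ∂volume.restrict (ball X r ∩ (Ω : Set (Rn n))), False := by
    filter_upwards [h0, hw0'] with Z h1 h2
    simp only [Pi.zero_apply, ENNReal.ofReal_eq_zero] at h1
    linarith
  rw [ae_iff] at hf
  simp only [not_false_eq_true, Set.ofPred_true, Measure.restrict_apply_univ] at hf
  obtain ⟨Y, hY, hXY⟩ := Metric.mem_closure_iff.1 hX r hr
  exact ((isOpen_ball.inter Ω.isOpen).measure_pos volume
    ⟨Y, by rwa [mem_ball, dist_comm], hY⟩).ne' hf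

lemma H4.mBall_pos {C₄ : ℝ≥0} (h4 : H4 Ω m C₄) {X : Rn n}
    (hX : X ∈ closure (Ω : Set (Rn n))) {r : ℝ} (hr : 0 < r) : 0 < mBall Ω m X r :=
  ENNReal.toReal_pos (h4.measure_ball_pos hX hr).ne' (h4.measure_ball_lt_top hX r).ne

/-- The form in which doubling is used throughout: the hypothesis says that `p` doublings of the
second ball cover the first. -/
lemma H4.mBall_le_mBall {C₄ : ℝ≥0} (h4 : H4 Ω m C₄) {X Y : Rn n}
    (hY : Y ∈ closure (Ω : Set (Rn n))) {r s : ℝ} (hs : 0 < s) (p : ℕ)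
    (h : r + dist X Y ≤ 2 ^ p * s) : mBall Ω m X r ≤ (C₄ : ℝ) ^ p * mBall Ω m Y s := by
  have h1 : m (ball X r ∩ Ω) ≤ (C₄ : ℝ≥0∞) ^ p * m (ball Y s ∩ Ω) := by
    refine (measure_mono ?_).trans (h4.measure_ball_two_pow_le hY hs p)
    gcongr
    exact ball_subset_ball' h
  have := ENNReal.toReal_mono (ENNReal.mul_lt_top (by finiteness)
    (h4.measure_ball_lt_top hY s)).ne h1
  simpa [mBall, Measure.real, ENNReal.toReal_mul] using this

/-- Provides the s-finiteness that Tonelli's theorem needs for the energy integrals. -/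
lemma H4.isLocallyFiniteMeasure {C₄ : ℝ≥0} (h4 : H4 Ω m C₄) :
    IsLocallyFiniteMeasure (m.restrict Ω) := by
  refine ⟨fun X => ?_⟩
  refine ⟨ball X 1, ball_mem_nhds X one_pos, ?_⟩
  rw [Measure.restrict_apply measurableSet_ball]
  rcases (ball X 1 ∩ (Ω : Set (Rn n))).eq_empty_or_nonempty with h | ⟨Y, hY, hYΩ⟩
  · simp [h]
  · refine (measure_mono ?_).trans_lt (h4.measure_ball_lt_top (subset_closure hYΩ) 2)
    gcongr
    rw [mem_ball, dist_comm] at hY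
    exact ball_subset_ball' (by linarith)

lemma H3.measure_ball_two_pow_le {C₃ : ℝ≥0} (h3 : H3 Ω μ C₃) {x : Rn n} (hx : x ∈ bdry Ω)
    {r : ℝ} (hr : 0 < r) (p : ℕ) :
    μ (ball x (2 ^ p * r)) ≤ (C₃ : ℝ≥0∞) ^ p * μ (ball x r) := by
  induction p with
  | zero => simp
  | succ p ih =>
    calc μ (ball x (2 ^ (p + 1) * r)) = μ (ball x (2 * (2 ^ p * r))) := by
          rw [pow_succ', mul_assoc]
      _ ≤ C₃ * μ (ball x (2 ^ p * r)) := h3.2 x hx _ (by positivity)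
      _ ≤ C₃ * ((C₃ : ℝ≥0∞) ^ p * μ (ball x r)) := by gcongr
      _ = _ := by rw [pow_succ', mul_assoc]

lemma H3.measure_ball_le {C₃ : ℝ≥0} (h3 : H3 Ω μ C₃) {x y : Rn n} (hy : y ∈ bdry Ω)
    {r s : ℝ} (hs : 0 < s) (p : ℕ) (h : r + dist x y ≤ 2 ^ p * s) :
    μ (ball x r) ≤ (C₃ : ℝ≥0∞) ^ p * μ (ball y s) :=
  (measure_mono (ball_subset_ball' h)).trans (h3.measure_ball_two_pow_le hy hs p)

lemma H3.measure_ball_pos {C₃ : ℝ≥0} (h3 : H3 Ω μ C₃) {x : Rn n} (hx : x ∈ bdry Ω)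
    {r : ℝ} (hr : 0 < r) : 0 < μ (ball x r) := by
  rw [← h3.1] at hx
  exact (Measure.mem_support_iff_forall x).1 hx _ (ball_mem_nhds x hr)

lemma H3.muBall_pos [IsLocallyFiniteMeasure μ] {C₃ : ℝ≥0} (h3 : H3 Ω μ C₃) {x : Rn n}
    (hx : x ∈ bdry Ω) {r : ℝ} (hr : 0 < r) : 0 < μ.real (ball x r) :=
  ENNReal.toReal_pos (h3.measure_ball_pos hx hr).ne' measure_ball_lt_top.ne

lemma H3.muBall_le [IsLocallyFiniteMeasure μ] {C₃ : ℝ≥0} (h3 : H3 Ω μ C₃) {x y : Rn n}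
    (hy : y ∈ bdry Ω) {r s : ℝ} (hs : 0 < s) (p : ℕ) (h : r + dist x y ≤ 2 ^ p * s) :
    μ.real (ball x r) ≤ (C₃ : ℝ) ^ p * μ.real (ball y s) := by
  have := ENNReal.toReal_mono (ENNReal.mul_lt_top (by finiteness)
    measure_ball_lt_top).ne (h3.measure_ball_le hy hs p h)
  simpa [Measure.real, ENNReal.toReal_mul] using this

lemma H3.ae_mem_bdry {C₃ : ℝ≥0} (h3 : H3 Ω μ C₃) : ∀ᵐ x ∂μ, x ∈ bdry Ω := by
  rw [← h3.1]
  exact Measure.support_mem_ae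

/-! ### The Poincaré inequality in `W` -/

lemma SmoothUpTo.mono {D D' : Set (Rn n)} {u : Rn n → ℝ} (hu : SmoothUpTo D u) (h : D' ⊆ D) :
    SmoothUpTo D' u := by
  refine ⟨hu.1.mono h, fun k => ?_⟩
  obtain ⟨g, hg, hg'⟩ := hu.2 k
  exact ⟨g, hg.mono (closure_mono h), hg'.mono h⟩

lemma integrableOn_ball {u : Rn n → ℝ} (hu : LocallyIntegrableOn u Ω m) {X : Rn n} {r : ℝ}
    (hr : 0 < r) (h : ball X (2 * r) ⊆ Ω) : IntegrableOn u (ball X r) m :=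
  ((hu.mono_set ((closedBall_subset_ball (by linarith)).trans h)).integrableOn_isCompact
    (isCompact_closedBall X r)).mono_set ball_subset_closedBall

lemma abs_average_sub_le {ν : Measure (Rn n)} [IsFiniteMeasure ν] {u : Rn n → ℝ}
    (hu : Integrable u ν) (hν : 0 < ν.real Set.univ) (c : ℝ) :
    |⨍ Z, u Z ∂ν - c| ≤ (ν.real Set.univ)⁻¹ * ∫ Z, |u Z - c| ∂ν := by
  have : ⨍ Z, u Z ∂ν - c = (ν.real Set.univ)⁻¹ * ∫ Z, (u Z - c) ∂ν := by
    rw [integral_sub hu (integrable_const c), average_eq, integral_const, smul_eq_mul, smul_eq_mul]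
    field_simp
  rw [this, abs_mul, abs_of_nonneg (by positivity : 0 ≤ (ν.real Set.univ)⁻¹)]
  gcongr
  exact abs_integral_le_integral_abs

/-- Mean oscillation is stable under small `L¹` perturbations, so the Poincaré inequality passes
from the smooth approximations to their limit. -/
lemma integral_abs_sub_average_le {ν : Measure (Rn n)} [IsFiniteMeasure ν] {u φ : Rn n → ℝ}
    (hu : Integrable u ν) (hφ : Integrable φ ν) (hν : 0 < ν.real Set.univ) :
    ∫ Z, |u Z - ⨍ Y, u Y ∂ν| ∂ν ≤ ∫ Z, |φ Z - ⨍ Y, φ Y ∂ν| ∂ν + 2 * ∫ Z, |φ Z - u Z| ∂ν := by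
  set a := ⨍ Y, u Y ∂ν
  set b := ⨍ Y, φ Y ∂ν
  have hd : Integrable (fun Z => |φ Z - u Z|) ν := (hφ.sub hu).abs
  have hab : |b - a| ≤ (ν.real Set.univ)⁻¹ * ∫ Z, |φ Z - u Z| ∂ν := by
    have : b - a = (ν.real Set.univ)⁻¹ * ∫ Z, (φ Z - u Z) ∂ν := by
      rw [integral_sub hφ hu]
      simp only [a, b, average_eq, smul_eq_mul]
      ring
    rw [this, abs_mul, abs_of_nonneg (by positivity : 0 ≤ (ν.real Set.univ)⁻¹)]
    gcongr
    exact abs_integral_le_integral_abs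
  have h1 : Integrable (fun Z => |φ Z - b|) ν := (hφ.sub (integrable_const b)).abs
  have h2 : Integrable (fun Z => |u Z - a|) ν := (hu.sub (integrable_const a)).abs
  calc ∫ Z, |u Z - a| ∂ν ≤ ∫ Z, (|φ Z - b| + |φ Z - u Z| + |b - a|) ∂ν := by
        refine integral_mono h2 ((h1.add hd).add (integrable_const _)) fun Z => ?_
        have : u Z - a = (φ Z - b) - (φ Z - u Z) + (b - a) := by ring
        simp only [this]
        exact (abs_add_le _ _).trans (add_le_add (abs_sub _ _) le_rfl)
    _ = ∫ Z, |φ Z - b| ∂ν + ∫ Z, |φ Z - u Z| ∂ν + ν.real Set.univ * |b - a| := by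
        rw [integral_add (f := fun Z => |φ Z - b| + |φ Z - u Z|) (h1.add hd) (integrable_const _),
          integral_add h1 hd, integral_const, smul_eq_mul]
    _ ≤ ∫ Z, |φ Z - b| ∂ν + ∫ Z, |φ Z - u Z| ∂ν +
          ν.real Set.univ * ((ν.real Set.univ)⁻¹ * ∫ Z, |φ Z - u Z| ∂ν) := by gcongr
    _ = _ := by rw [mul_inv_cancel_left₀ hν.ne']; ring

lemma toReal_eLpNorm_two {F : Type*} [NormedAddCommGroup F] (ν : Measure (Rn n)) (f : Rn n → F) :
    (eLpNorm f 2 ν).toReal = √(∫⁻ Z, ‖f Z‖ₑ ^ 2 ∂ν).toReal := by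
  rw [eLpNorm_eq_lintegral_rpow_enorm_toReal two_ne_zero ENNReal.ofNat_ne_top, Real.sqrt_eq_rpow,
    ENNReal.toReal_rpow]
  simp

/-- The weak Poincaré inequality for an element of `W`. -/
lemma IsWGrad.poincare {C₄ : ℝ≥0} {C₆ : ℝ} (h4 : H4 Ω m C₄) (h6 : H6 Ω m C₆) {u : Rn n → ℝ}
    {v : Rn n → Rn n} (h : IsWGrad Ω m u v) {X : Rn n} {r : ℝ} (hr : 0 < r)
    (hB : ball X (2 * r) ⊆ Ω) :
    ∫ Z in ball X r, |u Z - ⨍ Y in ball X r, u Y ∂m| ∂m ≤ max C₆ 0 * r * √(m.real (ball X r)) *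
      √(∫⁻ Z in ball X r, ‖v Z‖ₑ ^ 2 ∂m).toReal := by
  obtain ⟨hu, hv, φ, hφ, hgφ, hφu, hφv⟩ := h
  have hBΩ := ball_sub_double X hr hB
  have hX : X ∈ closure (Ω : Set (Rn n)) := subset_closure (hBΩ (mem_ball_self hr))
  have hfin : m (ball X r) < ⊤ := by
    have := h4.measure_ball_lt_top hX r
    rwa [Set.inter_eq_left.2 hBΩ] at this
  set ν := m.restrict (ball X r) with hν
  have : IsFiniteMeasure ν := ⟨by rwa [hν, Measure.restrict_apply_univ]⟩
  have hνu : ν.real Set.univ = m.real (ball X r) := by simp [hν]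
  have hpos : 0 < m.real (ball X r) := by
    rw [← mBall_eq_of_subset hBΩ]
    exact h4.mBall_pos hX hr
  have hui : Integrable u ν := integrableOn_ball hu hr hB
  have hνle : ν ≤ m.restrict Ω := Measure.restrict_mono_set m hBΩ
  have hvν : MemLp v 2 ν := hv.mono_measure hνle
  have hgν : ∀ i, MemLp (gradient (φ i)) 2 ν := fun i => (hgφ i).mono_measure hνle
  have t1 : Tendsto (fun i => (eLpNorm (fun Z => φ i Z - u Z) 1 ν).toReal) atTop (𝓝 0) :=
    (ENNReal.tendsto_toReal ENNReal.zero_ne_top).comp (hφu X r hr hB)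
  have t2 : Tendsto (fun i => (eLpNorm (fun Z => gradient (φ i) Z - v Z) 2 ν).toReal)
      atTop (𝓝 0) := by
    refine (ENNReal.tendsto_toReal_zero_iff fun i => ((hgν i).sub hvν).2.ne).2 ?_
    exact tendsto_of_tendsto_of_tendsto_of_le_of_le tendsto_const_nhds hφv
      (fun _ => zero_le) fun i => eLpNorm_mono_measure _ hνle
  rw [← toReal_eLpNorm_two]
  -- (H6) does not give `C₆` a sign; monotonicity in the other factors needs a nonnegative constant.
  set K := max C₆ 0 * r * √(m.real (ball X r)) with hK
  have hK0 : 0 ≤ K := by positivity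
  have tlim : Tendsto (fun i => K * ((eLpNorm v 2 ν).toReal +
      (eLpNorm (fun Z => gradient (φ i) Z - v Z) 2 ν).toReal) +
      2 * (eLpNorm (fun Z => φ i Z - u Z) 1 ν).toReal) atTop
      (𝓝 (K * ((eLpNorm v 2 ν).toReal + 0) + 2 * 0)) :=
    ((t2.const_add _).const_mul K).add (t1.const_mul 2)
  rw [add_zero, mul_zero, add_zero] at tlim
  refine ge_of_tendsto tlim ?_
  -- Finiteness of this norm, for large `i`, is what makes `φ i` integrable on the ball.
  filter_upwards [(hφu X r hr hB).eventually_lt_const one_pos] with i hi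
  have hdi : Integrable (fun Z => φ i Z - u Z) ν :=
    memLp_one_iff_integrable.1 ⟨((hφ i).aesm measurableSet_ball hBΩ).sub
      hui.aestronglyMeasurable, hi.trans ENNReal.one_lt_top⟩
  have hφi : Integrable (φ i) ν := by
    refine (hdi.add hui).congr (ae_of_all _ fun Z => ?_)
    simp
  have h1 : ∫ Z, |φ i Z - u Z| ∂ν = (eLpNorm (fun Z => φ i Z - u Z) 1 ν).toReal := by
    rw [eLpNorm_one_eq_lintegral_enorm,
      ← integral_norm_eq_lintegral_enorm hdi.aestronglyMeasurable]
    rfl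
  have h2 : ∫ Z, |φ i Z - ⨍ Y, φ i Y ∂ν| ∂ν ≤ K * (eLpNorm (gradient (φ i)) 2 ν).toReal := by
    have hp := h6.2 X r hr hB (φ i) ((hφ i).mono hBΩ)
    rw [← hν, average_eq, average_eq _ (fun Z => ‖gradient (φ i) Z‖ ^ 2), hνu, smul_eq_mul,
      smul_eq_mul, Real.sqrt_mul (by positivity), Real.sqrt_inv] at hp
    have hE : √(∫ Z, ‖gradient (φ i) Z‖ ^ 2 ∂ν) = (eLpNorm (gradient (φ i)) 2 ν).toReal := by
      rw [toReal_eLpNorm_two, integral_eq_lintegral_of_nonneg_ae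
        (ae_of_all _ fun Z => sq_nonneg _)
        ((hgν i).aestronglyMeasurable.norm.pow 2 :)]
      congr 2
      refine lintegral_congr fun Z => ?_
      rw [ENNReal.ofReal_pow (norm_nonneg _), ofReal_norm]
    rw [hE] at hp
    rw [inv_mul_le_iff₀ hpos] at hp
    refine hp.trans ?_
    have hs : 0 < √(m.real (ball X r)) := Real.sqrt_pos.2 hpos
    have hss : m.real (ball X r) = √(m.real (ball X r)) * √(m.real (ball X r)) :=
      (Real.mul_self_sqrt hpos.le).symm
    have : m.real (ball X r) * (C₆ * r * ((√(m.real (ball X r)))⁻¹ *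
        (eLpNorm (gradient (φ i)) 2 ν).toReal)) =
        C₆ * r * √(m.real (ball X r)) * (eLpNorm (gradient (φ i)) 2 ν).toReal := by
      nth_rw 1 [hss]
      field_simp
    rw [this, hK]
    gcongr
    exact le_max_left _ _
  have h3 : (eLpNorm (gradient (φ i)) 2 ν).toReal ≤ (eLpNorm v 2 ν).toReal +
      (eLpNorm (fun Z => gradient (φ i) Z - v Z) 2 ν).toReal := by
    change _ ≤ _ + (eLpNorm (gradient (φ i) - v) 2 ν).toReal
    rw [← ENNReal.toReal_add hvν.2.ne ((hgν i).sub hvν).2.ne]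
    refine ENNReal.toReal_mono (ENNReal.add_lt_top.2 ⟨hvν.2, ((hgν i).sub hvν).2⟩).ne ?_
    have := eLpNorm_add_le hvν.1 ((hgν i).sub hvν).1 one_le_two
    rwa [add_sub_cancel] at this
  calc _ ≤ _ := integral_abs_sub_average_le hui hφi (by rw [hνu]; exact hpos)
    _ ≤ _ := by
      rw [h1]
      gcongr
      exact h2.trans (by gcongr)

/-! ### Oscillation along Harnack chains -/

/-- The function `u` satisfies a weak Poincaré inequality in interior balls, where the density
`F` stands for the square of the norm of a gradient. -/
structure HasPoincare (Ω : TopologicalSpace.Opens (Rn n)) (m : Measure (Rn n)) (K : ℝ)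
    (u : Rn n → ℝ) (F : Rn n → ℝ≥0∞) : Prop where
  locallyIntegrableOn : LocallyIntegrableOn u Ω m
  measurable : Measurable F
  lintegral_lt_top : ∫⁻ Z, F Z ∂m.restrict Ω < ⊤
  poincare : ∀ (X : Rn n) (r : ℝ), 0 < r → ball X (2 * r) ⊆ Ω →
    ∫ Z in ball X r, |u Z - ⨍ Y in ball X r, u Y ∂m| ∂m ≤ K * r * √(mBall Ω m X r) *
      √(∫⁻ Z in ball X r, F Z ∂m.restrict Ω).toReal

/-- The density is built from a strongly measurable representative of the gradient, since the later
Tonelli arguments ask for a genuinely measurable function. -/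
lemma IsWGrad.hasPoincare {C₄ : ℝ≥0} {C₆ : ℝ} (h4 : H4 Ω m C₄) (h6 : H6 Ω m C₆) {u : Rn n → ℝ}
    {v : Rn n → Rn n} (h : IsWGrad Ω m u v) :
    ∃ F, HasPoincare Ω m (max C₆ 0) u F ∧
      ∫⁻ Z, F Z ∂m.restrict Ω = ENNReal.ofReal (∫ Z in Ω, ‖v Z‖ ^ 2 ∂m) := by
  have hv := h.2.1
  have hae : (fun Z => ‖hv.1.mk v Z‖ₑ ^ 2) =ᵐ[m.restrict Ω] fun Z => ‖v Z‖ₑ ^ 2 := by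
    filter_upwards [hv.1.ae_eq_mk] with Z hZ
    rw [hZ]
  have hint : ∫⁻ Z, ‖hv.1.mk v Z‖ₑ ^ 2 ∂m.restrict Ω =
      ENNReal.ofReal (∫ Z in Ω, ‖v Z‖ ^ 2 ∂m) := by
    rw [lintegral_congr_ae hae, ofReal_integral_eq_lintegral_ofReal
      ((memLp_two_iff_integrable_sq_norm hv.1).1 hv) (ae_of_all _ fun Z => sq_nonneg _)]
    refine lintegral_congr fun Z => ?_
    rw [ENNReal.ofReal_pow (norm_nonneg _), ofReal_norm]
  refine ⟨fun Z => ‖hv.1.mk v Z‖ₑ ^ 2, ⟨h.1, ?_, ?_, fun X r hr hB => ?_⟩, hint⟩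
  · exact hv.1.stronglyMeasurable_mk.enorm.pow_const 2
  · rw [hint]
    exact ENNReal.ofReal_lt_top
  · have hBΩ := ball_sub_double X hr hB
    rw [lintegral_congr_ae (ae_restrict_of_ae hae),
      Measure.restrict_restrict_of_subset hBΩ, mBall_eq_of_subset hBΩ]
    exact h.poincare h4 h6 hr hB

/-- The part of a ball of radius comparable to `r` around `x` whose distance to the boundary is
comparable to `r`. -/
def shadow (Ω : TopologicalSpace.Opens (Rn n)) (M : ℝ) (x : Rn n) (r : ℝ) : Set (Rn n) :=
  {Z | dist Z x < M * r ∧ r < M * δ Ω Z}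

lemma delta_nonneg (X : Rn n) : 0 ≤ δ Ω X := infDist_nonneg

lemma shadow_mono {M M' : ℝ} (h : M ≤ M') (x : Rn n) {r : ℝ} (hr : 0 < r) :
    shadow Ω M x r ⊆ shadow Ω M' x r := fun Z hZ =>
  ⟨hZ.1.trans_le (by gcongr), hZ.2.trans_le (by gcongr; exact delta_nonneg Z)⟩

/-- The average of `u` on `B(X, δ(X)/2)`. -/
noncomputable def avg (Ω : TopologicalSpace.Opens (Rn n)) (m : Measure (Rn n)) (u : Rn n → ℝ)
    (X : Rn n) : ℝ := ⨍ Z in ball X (δ Ω X / 2), u Z ∂m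

/-- The energy of `u` in a shadow, normalized to control oscillations of `u` there. -/
noncomputable def oscBound (Ω : TopologicalSpace.Opens (Rn n)) (m : Measure (Rn n))
    (F : Rn n → ℝ≥0∞) (M : ℝ) (x : Rn n) (r : ℝ) : ℝ :=
  M * r / √(mBall Ω m x r) * √(∫⁻ Z in shadow Ω M x r, F Z ∂m.restrict Ω).toReal

lemma HasPoincare.setLIntegral_lt_top {K : ℝ} {u : Rn n → ℝ} {F : Rn n → ℝ≥0∞}
    (h : HasPoincare Ω m K u F) (T : Set (Rn n)) : ∫⁻ Z in T, F Z ∂m.restrict Ω < ⊤ :=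
  (setLIntegral_le_lintegral _ _).trans_lt h.lintegral_lt_top

lemma HasPoincare.setLIntegral_mono {K : ℝ} {u : Rn n → ℝ} {F : Rn n → ℝ≥0∞}
    (h : HasPoincare Ω m K u F) {S T : Set (Rn n)} (hST : S ⊆ T) :
    (∫⁻ Z in S, F Z ∂m.restrict Ω).toReal ≤ (∫⁻ Z in T, F Z ∂m.restrict Ω).toReal :=
  ENNReal.toReal_mono (h.setLIntegral_lt_top T).ne (lintegral_mono_set hST)

lemma HasPoincare.oscBound_mono {K : ℝ} {u : Rn n → ℝ} {F : Rn n → ℝ≥0∞}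
    (h : HasPoincare Ω m K u F) {M M' : ℝ} (hM : 0 ≤ M) (hMM : M ≤ M') (x : Rn n) {r : ℝ}
    (hr : 0 < r) : oscBound Ω m F M x r ≤ oscBound Ω m F M' x r := by
  unfold oscBound
  have := h.setLIntegral_mono (shadow_mono (Ω := Ω) hMM x hr)
  have := hM.trans hMM
  gcongr

lemma oscBound_nonneg (F : Rn n → ℝ≥0∞) {M : ℝ} (hM : 0 ≤ M) (x : Rn n) {r : ℝ} (hr : 0 < r) :
    0 ≤ oscBound Ω m F M x r := by
  unfold oscBound
  positivity

/-- Here it pays that one parameter is both the constant in front and the aperture of the shadow: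
bounds along a chain add up by adding parameters. -/
lemma HasPoincare.oscBound_add_le {K : ℝ} {u : Rn n → ℝ} {F : Rn n → ℝ≥0∞}
    (h : HasPoincare Ω m K u F) {M M' : ℝ} (hM : 0 ≤ M) (hM' : 0 ≤ M') (x : Rn n) {r : ℝ}
    (hr : 0 < r) :
    oscBound Ω m F M x r + oscBound Ω m F M' x r ≤ oscBound Ω m F (M + M') x r := by
  unfold oscBound
  have h1 := h.setLIntegral_mono (shadow_mono (Ω := Ω) (le_add_of_nonneg_right hM' : M ≤ _) x hr)
  have h2 := h.setLIntegral_mono (shadow_mono (Ω := Ω) (le_add_of_nonneg_left hM : M' ≤ _) x hr)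
  rw [add_mul M M' r, add_div, add_mul]
  gcongr

/-- The oscillation in an interior ball, compared with the measure of a smaller ball. -/
lemma exists_osc_ball {C₄ : ℝ≥0} (h4 : H4 Ω m C₄) (K A : ℝ) (hK : 0 ≤ K) (hA : 0 < A) :
    ∃ M, 0 < M ∧ ∀ (u : Rn n → ℝ) (F : Rn n → ℝ≥0∞), HasPoincare Ω m K u F →
      ∀ (x X Y : Rn n) (r s t : ℝ), x ∈ bdry Ω → 0 < r → 0 < s → 0 < t → ball X (2 * s) ⊆ Ω →
        dist X x + s ≤ A * r → ball X s ⊆ shadow Ω A x r → r + dist Y x ≤ A * t →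
        ball Y t ⊆ ball X s →
        (m.real (ball Y t))⁻¹ * ∫ Z in ball X s, |u Z - ⨍ Y in ball X s, u Y ∂m| ∂m ≤
          oscBound Ω m F M x r := by
  obtain ⟨p, hp⟩ := pow_unbounded_of_one_lt A one_lt_two
  set D : ℝ := (C₄ : ℝ) ^ p with hD
  -- One `D` compares `m(B(Y,t))` with `m(B(x,r) ∩ Ω)`, `√D` does so for `B(X,s)`, and `K * A` comes
  -- from Poincaré with `s ≤ A * r`. The summand `A` widens the shadow enough to contain `B(X,s)`.
  refine ⟨D * K * A * √D + A, by positivity, ?_⟩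
  intro u F hu x X Y r s t hx hr hs ht hXs hXx hsh hYx hYX
  have hsub := ball_sub_double X hs hXs
  have hYΩ : Y ∈ Ω := hsub (hYX (mem_ball_self ht))
  have hxc := bdry_subset_closure hx
  have e1 : mBall Ω m X s ≤ D * mBall Ω m x r := by
    refine h4.mBall_le_mBall hxc hr p ?_
    rw [add_comm]
    exact hXx.trans (by gcongr)
  have e2 : mBall Ω m x r ≤ D * m.real (ball Y t) := by
    rw [← mBall_eq_of_subset (hYX.trans hsub)]
    refine h4.mBall_le_mBall (subset_closure hYΩ) ht p ?_
    rw [dist_comm x Y]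
    exact hYx.trans (by gcongr)
  have p1 : 0 < mBall Ω m x r := h4.mBall_pos hxc hr
  have p2 : 0 < m.real (ball Y t) := by
    rw [← mBall_eq_of_subset (hYX.trans hsub)]
    exact h4.mBall_pos (subset_closure hYΩ) ht
  have e3 : (m.real (ball Y t))⁻¹ ≤ D / mBall Ω m x r := by
    rw [inv_eq_one_div, div_le_div_iff₀ p2 p1, one_mul]
    exact e2
  have hs' : s ≤ A * r := by linarith [dist_nonneg (x := X) (y := x)]
  set M := D * K * A * √D + A with hM
  have hAM : A ≤ M := le_add_of_nonneg_left (by positivity)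
  set e := (∫⁻ Z in shadow Ω M x r, F Z ∂m.restrict Ω).toReal with he
  have e4 : (∫⁻ Z in ball X s, F Z ∂m.restrict Ω).toReal ≤ e :=
    hu.setLIntegral_mono (hsh.trans (shadow_mono hAM x hr))
  calc (m.real (ball Y t))⁻¹ * ∫ Z in ball X s, |u Z - ⨍ Y in ball X s, u Y ∂m| ∂m
      ≤ D / mBall Ω m x r * (K * s * √(mBall Ω m X s) *
          √(∫⁻ Z in ball X s, F Z ∂m.restrict Ω).toReal) := by
        gcongr
        exact hu.poincare X s hs hXs
    _ ≤ D / mBall Ω m x r * (K * (A * r) * √(D * mBall Ω m x r) * √e) := by gcongr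
    _ = (D * K * A * √D) * r / √(mBall Ω m x r) * √e := by
        rw [Real.sqrt_mul (by positivity)]
        have hq : 0 < √(mBall Ω m x r) := Real.sqrt_pos.2 p1
        have hqq : mBall Ω m x r = √(mBall Ω m x r) * √(mBall Ω m x r) :=
          (Real.mul_self_sqrt p1.le).symm
        rw [div_mul_eq_mul_div, div_mul_eq_mul_div, div_eq_div_iff p1.ne' hq.ne']
        linear_combination (-(D * K * A * √D * r * √e)) * hqq
    _ ≤ M * r / √(mBall Ω m x r) * √e := by
        gcongr
        exact le_add_of_nonneg_right hA.le
    _ = _ := rfl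

lemma abs_average_sub_average_le {C₄ : ℝ≥0} (h4 : H4 Ω m C₄) {u : Rn n → ℝ}
    (hu : LocallyIntegrableOn u Ω m) {X Y : Rn n} {s t : ℝ} (hs : 0 < s) (ht : 0 < t)
    (hXs : ball X (2 * s) ⊆ Ω) (hYX : ball Y t ⊆ ball X s) (c : ℝ) :
    |⨍ Z in ball Y t, u Z ∂m - c| ≤
      (m.real (ball Y t))⁻¹ * ∫ Z in ball X s, |u Z - c| ∂m := by
  have hsub := ball_sub_double X hs hXs
  have hYΩ : Y ∈ Ω := hsub (hYX (mem_ball_self ht))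
  have hpos : 0 < m.real (ball Y t) := by
    rw [← mBall_eq_of_subset (hYX.trans hsub)]
    exact h4.mBall_pos (subset_closure hYΩ) ht
  have hfinX : m (ball X s) < ⊤ := by
    have := h4.measure_ball_lt_top (subset_closure (hsub (mem_ball_self hs))) s
    rwa [Set.inter_eq_left.2 hsub] at this
  have hfinY : m (ball Y t) < ⊤ := (measure_mono hYX).trans_lt hfinX
  have : IsFiniteMeasure (m.restrict (ball Y t)) := ⟨by rwa [Measure.restrict_apply_univ]⟩
  have hXi : IntegrableOn u (ball X s) m := integrableOn_ball hu hs hXs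
  have hY : (m.restrict (ball Y t)).real Set.univ = m.real (ball Y t) := by simp
  refine (abs_average_sub_le (hXi.mono_set hYX) (by rwa [hY]) c).trans ?_
  rw [hY]
  refine mul_le_mul_of_nonneg_left ?_ (inv_nonneg.2 hpos.le)
  refine setIntegral_mono_set ?_ (ae_of_all _ fun Z => abs_nonneg (u Z - c)) hYX.eventuallyLE
  exact (Integrable.sub hXi (integrableOn_const hfinX.ne)).abs

/-- The oscillation of `u` in `B(X, δ(X)/2)`. -/
lemma exists_osc_self {C₄ : ℝ≥0} (h4 : H4 Ω m C₄) (hΓ : (bdry Ω).Nonempty) (K A : ℝ) (hK : 0 ≤ K)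
    (hA : 0 < A) :
    ∃ M, 0 < M ∧ ∀ (u : Rn n → ℝ) (F : Rn n → ℝ≥0∞), HasPoincare Ω m K u F →
      ∀ (x X : Rn n) (r : ℝ), x ∈ bdry Ω → 0 < r → X ∈ Ω → dist X x ≤ A * r → r ≤ A * δ Ω X →
        ⨍ Z in ball X (δ Ω X / 2), |u Z - avg Ω m u X| ∂m ≤ oscBound Ω m F M x r := by
  -- With `t = δ(X)/2`, this is the constant in `r + dist X x ≤ (A + A²) δ(X)`; it also exceeds what
  -- the other two conditions need.
  obtain ⟨M, hM, h⟩ := exists_osc_ball h4 K (2 * A ^ 2 + 2 * A) hK (by positivity)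
  refine ⟨M, hM, fun u F hu x X r hx hr hX hXx hrX => ?_⟩
  have hδ := delta_pos hΓ hX
  have hδx := delta_le_dist hx X
  have hA2 : dist X x ≤ A ^ 2 * δ Ω X := by nlinarith
  have hAr : 0 < A * r := by positivity
  have hA2r : 0 < A ^ 2 * r := by positivity
  rw [average_eq, smul_eq_mul]
  simp only [measureReal_restrict_apply_univ]
  refine h u F hu x X X r (δ Ω X / 2) (δ Ω X / 2) hx hr (by positivity) (by positivity)
    (ball_half_delta_subset hX) ?_ ?_ ?_ subset_rfl
  · linarith
  · intro Z hZ
    rw [mem_ball] at hZ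
    have h1 := dist_triangle Z X x
    have h2 := delta_le_add (Ω := Ω) X Z
    rw [dist_comm X Z] at h2
    refine ⟨by linarith, ?_⟩
    have h3 : δ Ω X < 2 * δ Ω Z := by linarith
    have h4 : A * δ Ω X < A * (2 * δ Ω Z) := by gcongr
    have h5 : 0 ≤ A ^ 2 * δ Ω Z := mul_nonneg (sq_nonneg _) (delta_nonneg Z)
    linarith
  · linarith

/-- The averages of `u` on two neighboring Whitney balls. -/
lemma exists_osc_step {C₄ : ℝ≥0} (h4 : H4 Ω m C₄) (hΓ : (bdry Ω).Nonempty) (K A : ℝ) (hK : 0 ≤ K)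
    (hA : 0 < A) :
    ∃ M, 0 < M ∧ ∀ (u : Rn n → ℝ) (F : Rn n → ℝ≥0∞), HasPoincare Ω m K u F →
      ∀ (x X Y : Rn n) (r : ℝ), x ∈ bdry Ω → 0 < r → X ∈ Ω → dist X Y < 1 / 2 * δ Ω X →
        dist X x ≤ A * r → r ≤ A * δ Ω X →
        |avg Ω m u X - avg Ω m u Y| ≤ oscBound Ω m F M x r := by
  obtain ⟨M, hM, h⟩ := exists_osc_ball h4 K (8 * A ^ 2 + 8 * A + 8) hK (by positivity)
  refine ⟨M + M, by positivity, fun u F hu x X Y r hx hr hX hXY hXx hrX => ?_⟩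
  have hδ := delta_pos hΓ hX
  have hδx := delta_le_dist hx X
  have hA2 : dist X x ≤ A ^ 2 * δ Ω X := by nlinarith
  have hAr : 0 < A * r := by positivity
  have hA2r : 0 < A ^ 2 * r := by positivity
  have hAδ : 0 < A * δ Ω X := by positivity
  have hY : Y ∈ Ω := mem_of_dist_lt_delta hX (by linarith)
  have hYδ := delta_pos hΓ hY
  have hXδY := delta_le_add (Ω := Ω) X Y
  have hYδX := delta_le_add (Ω := Ω) Y X
  have hYx := dist_triangle Y X x
  rw [dist_comm Y X] at hYδX hYx
  -- Since `δ(Y) > δ(X)/2`, the ball `B(P, δ(X)/8)` lies in both Whitney balls: `3/8 + 1/8 = 1/2` on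
  -- the side of `X`, and `1/8 + 1/8 = 1/4` on the side of `Y`. Both averages are compared with the
  -- one over this ball.
  set P : Rn n := Y + (1 / 4 : ℝ) • (X - Y) with hP
  have hPY : dist P Y = 1 / 4 * dist X Y := by
    rw [hP, dist_eq_norm, add_sub_cancel_left, norm_smul, dist_eq_norm]
    norm_num
  have hPX : dist P X = 3 / 4 * dist X Y := by
    rw [hP, dist_eq_norm, show Y + (1 / 4 : ℝ) • (X - Y) - X = (-3 / 4 : ℝ) • (X - Y) by module,
      norm_smul, dist_eq_norm]
    norm_num
  have hPXb : ball P (δ Ω X / 8) ⊆ ball X (δ Ω X / 2) := ball_subset_ball' (by linarith)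
  have hPYb : ball P (δ Ω X / 8) ⊆ ball Y (δ Ω Y / 2) := ball_subset_ball' (by linarith)
  have hPx : r + dist P x ≤ (8 * A ^ 2 + 8 * A + 8) * (δ Ω X / 8) := by
    have := dist_triangle P X x
    linarith
  have shadow_sub : ∀ Q : Rn n, dist Q x ≤ 3 / 2 * (A * r) → δ Ω Q ≤ 3 / 2 * δ Ω X →
      δ Ω X / 2 ≤ δ Ω Q → ball Q (δ Ω Q / 2) ⊆ shadow Ω (8 * A ^ 2 + 8 * A + 8) x r := by
    intro Q h1 h1' h2 Z hZ
    rw [mem_ball] at hZ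
    have h3 := dist_triangle Z Q x
    have h4 := delta_le_add (Ω := Ω) Q Z
    rw [dist_comm Q Z] at h4
    refine ⟨by linarith, ?_⟩
    have h5 : A * δ Ω X < A * (4 * δ Ω Z) := by gcongr; linarith
    have h6 : 0 ≤ A ^ 2 * δ Ω Z := mul_nonneg (sq_nonneg _) (delta_nonneg Z)
    linarith [delta_nonneg (Ω := Ω) Z]
  have e1 := (abs_average_sub_average_le h4 hu.locallyIntegrableOn (by positivity) (by positivity)
    (ball_half_delta_subset hX) hPXb (avg Ω m u X)).trans
    (h u F hu x X P r (δ Ω X / 2) (δ Ω X / 8) hx hr (by positivity) (by positivity)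
      (ball_half_delta_subset hX) (by linarith)
      (shadow_sub X (by linarith) (by linarith) (by linarith)) hPx hPXb)
  have e2 := (abs_average_sub_average_le h4 hu.locallyIntegrableOn (by positivity) (by positivity)
    (ball_half_delta_subset hY) hPYb (avg Ω m u Y)).trans
    (h u F hu x Y P r (δ Ω Y / 2) (δ Ω X / 8) hx hr (by positivity) (by positivity)
      (ball_half_delta_subset hY) (by linarith)
      (shadow_sub Y (by linarith) (by linarith) (by linarith)) hPx hPYb)
  rw [abs_sub_comm] at e1
  refine (abs_sub_le _ _ _).trans ((add_le_add e1 e2).trans ?_)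
  exact hu.oscBound_add_le hM.le hM.le x hr

/-- A chain of points of `Ω`, with steps shorter than half the distance to the boundary. -/
inductive Chain (Ω : TopologicalSpace.Opens (Rn n)) : ℕ → Rn n → Rn n → Prop
  | nil (X : Rn n) : X ∈ Ω → Chain Ω 0 X X
  | cons (l : ℕ) (X Y Z : Rn n) : X ∈ Ω → dist X Y < 1 / 2 * δ Ω X → Chain Ω l Y Z →
      Chain Ω (l + 1) X Z

lemma Chain.trans {k l : ℕ} {X Y Z : Rn n} (h : Chain Ω k X Y) (h' : Chain Ω l Y Z) :
    Chain Ω (k + l) X Z := by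
  induction h with
  | nil X hX => simpa using h'
  | cons k X P Y hX hXP _ ih =>
    rw [Nat.succ_add]
    exact Chain.cons _ _ _ _ hX hXP (ih h')

lemma chain_of_points (N : ℕ) : ∀ Z : ℕ → Rn n, (∀ i ≤ N, Z i ∈ Ω) →
    (∀ i < N, dist (Z i) (Z (i + 1)) < 1 / 2 * δ Ω (Z i)) → Chain Ω N (Z 0) (Z N) := by
  induction N with
  | zero => exact fun Z h _ => Chain.nil _ (h 0 le_rfl)
  | succ N ih =>
    intro Z h1 h2
    refine Chain.cons N _ (Z 1) _ (h1 0 (Nat.zero_le _)) (h2 0 N.succ_pos) ?_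
    exact ih (fun i => Z (i + 1)) (fun i hi => h1 _ (by omega)) (fun i hi => h2 _ (by omega))

lemma H2.chain {C₁ : ℝ} {N : ℕ} (h2 : H2 Ω C₁ N) {r : ℝ} (hr : 0 < r) {X Y : Rn n} (hX : X ∈ Ω)
    (hY : Y ∈ Ω) (hXr : r < δ Ω X) (hYr : r < δ Ω Y) (hXY : dist X Y ≤ 7 * C₁ * r) :
    Chain Ω N X Y := by
  obtain ⟨Z, rfl, rfl, h, h'⟩ := h2 r hr X hX Y hY hXr hYr hXY
  exact chain_of_points N Z h h'

/-- The averages of `u` on two Whitney balls joined by a Harnack chain. -/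
lemma exists_osc_chain {C₄ : ℝ≥0} (h4 : H4 Ω m C₄) (hΓ : (bdry Ω).Nonempty) (K : ℝ) (hK : 0 ≤ K)
    (L : ℕ) : ∀ A : ℝ, 0 < A →
    ∃ M, 0 < M ∧ ∀ (u : Rn n → ℝ) (F : Rn n → ℝ≥0∞), HasPoincare Ω m K u F →
      ∀ (x X Y : Rn n) (r : ℝ), x ∈ bdry Ω → 0 < r → Chain Ω L X Y →
        dist X x ≤ A * r → r ≤ A * δ Ω X →
        |avg Ω m u X - avg Ω m u Y| ≤ oscBound Ω m F M x r := by
  induction L with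
  | zero =>
    refine fun A hA => ⟨1, one_pos, fun u F hu x X Y r hx hr h _ _ => ?_⟩
    cases h
    rw [sub_self, abs_zero]
    exact oscBound_nonneg F zero_le_one x hr
  | succ L ih =>
    intro A hA
    obtain ⟨M, hM, h⟩ := exists_osc_step h4 hΓ K A hK hA
    -- One step of the chain moves by less than `δ(X)/2 ≤ A r / 2` and at most halves the distance
    -- to `Γ`, so doubling `A` suffices. This is why `A` is quantified inside the induction.
    obtain ⟨M', hM', h'⟩ := ih (2 * A) (by positivity)
    refine ⟨M + M', by positivity, fun u F hu x X Y r hx hr hXY hXx hrX => ?_⟩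
    cases hXY with
    | cons _ _ P _ hX hXP hPY =>
      have hδ := delta_pos hΓ hX
      have hAr : 0 < A * r := by positivity
      have h1 := delta_le_dist hx X
      have h2 := dist_triangle P X x
      have h3 := delta_le_add (Ω := Ω) X P
      rw [dist_comm P X] at h2
      have h5 : A * δ Ω X ≤ A * (2 * δ Ω P) := by gcongr; linarith
      refine (abs_sub_le _ (avg Ω m u P) _).trans
        ((add_le_add (h u F hu x X P r hx hr hX hXP hXx hrX)
          (h' u F hu x P Y r hx hr hPY (by linarith) (by linarith))).trans ?_)
      exact hu.oscBound_add_le hM.le hM'.le x hr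

/-! ### Corkscrew points -/

/-- `X` is a corkscrew point for `B(x,r)`, with slightly worse constants than in `H1`. -/
def Cork (Ω : TopologicalSpace.Opens (Rn n)) (C₁ : ℝ) (x : Rn n) (r : ℝ) (X : Rn n) : Prop :=
  X ∈ Ω ∧ dist X x < r ∧ 3 / 4 * (C₁⁻¹ * r) < δ Ω X

/-- The radii for which `H1` provides corkscrew points. -/
def Adm (Ω : TopologicalSpace.Opens (Rn n)) (r : ℝ) : Prop :=
  Bornology.IsBounded (Ω : Set (Rn n)) → r < diam (Ω : Set (Rn n))

lemma Adm.mono {r s : ℝ} (h : Adm Ω r) (hs : s ≤ r) : Adm Ω s := fun hb => hs.trans_lt (h hb)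

/-- (H1) gives `δ(X) ≥ C₁⁻¹ r`. The loss of the factor `3/4` makes the inequality strict, hence open
in `X`, as the choice from a dense sequence requires. -/
lemma H1.exists_cork {C₁ : ℝ} (h1 : H1 Ω C₁) {x : Rn n} (hx : x ∈ bdry Ω) {r : ℝ} (hr : 0 < r)
    (ha : Adm Ω r) : ∃ X, Cork Ω C₁ x r X := by
  obtain ⟨X, hX, hB⟩ := h1.2 x hx r hr ha
  have hC := h1.1
  have hpos : 0 < C₁⁻¹ * r := by positivity
  refine ⟨X, hB (mem_ball_self hpos), hX, ?_⟩
  have : C₁⁻¹ * r ≤ δ Ω X := by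
    refine (le_infDist ⟨x, hx⟩).2 fun y hy => ?_
    by_contra! h
    exact notMem_bdry (hB (by rwa [mem_ball, dist_comm])) hy
  linarith

lemma cork_chain_half {C₁ : ℝ} (hC : 0 < C₁) {N : ℕ} (h2 : H2 Ω C₁ N) {x X Y : Rn n} {r : ℝ}
    (hr : 0 < r) (hX : Cork Ω C₁ x r X) (hY : Cork Ω C₁ x (r / 2) Y) : Chain Ω N X Y := by
  have hp : 0 < C₁⁻¹ * r := by positivity
  refine h2.chain (r := 3 / 4 * (C₁⁻¹ * (r / 2))) (by positivity) hX.1 hY.1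
    (by linarith [hX.2.2]) hY.2.2 ?_
  have h := dist_triangle_right X Y x
  rw [show 7 * C₁ * (3 / 4 * (C₁⁻¹ * (r / 2))) = 21 / 8 * r by field_simp; norm_num]
  linarith [hX.2.1, hY.2.1]

/-- The tightest use of the factor `7` of (H2): the points are at distance less than `r + 2r + r =
4r`, and the factor `3/4` leaves an allowance of `21r/4`. -/
lemma cork_chain_near {C₁ : ℝ} (hC : 0 < C₁) {N : ℕ} (h2 : H2 Ω C₁ N) {x y X Y : Rn n} {r : ℝ}
    (hr : 0 < r) (hxy : dist x y ≤ 2 * r) (hX : Cork Ω C₁ x r X) (hY : Cork Ω C₁ y r Y) :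
    Chain Ω N X Y := by
  refine h2.chain (r := 3 / 4 * (C₁⁻¹ * r)) (by positivity) hX.1 hY.1 hX.2.2 hY.2.2 ?_
  have h := dist_triangle4_right X Y x y
  rw [show 7 * C₁ * (3 / 4 * (C₁⁻¹ * r)) = 21 / 4 * r by field_simp; norm_num]
  linarith [hX.2.1, hY.2.1]

lemma cork_chain_double {C₁ : ℝ} (hC : 0 < C₁) {N : ℕ} (h2 : H2 Ω C₁ N) {x X Y : Rn n} {r : ℝ}
    (hr : 0 < r) (hX : Cork Ω C₁ x r X) (hY : Cork Ω C₁ x (2 * r) Y) : Chain Ω N X Y := by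
  have hp : 0 < C₁⁻¹ * r := by positivity
  refine h2.chain (r := 3 / 4 * (C₁⁻¹ * r)) (by positivity) hX.1 hY.1
    hX.2.2 (by linarith [hY.2.2]) ?_
  have h := dist_triangle_right X Y x
  rw [show 7 * C₁ * (3 / 4 * (C₁⁻¹ * r)) = 21 / 4 * r by field_simp; norm_num]
  linarith [hX.2.1, hY.2.1]

/-- A point of a nontangential cone is joined to a corkscrew point at a larger scale. -/
lemma nontangential_chain {C₁ : ℝ} (h1 : H1 Ω C₁) {N : ℕ} (h2 : H2 Ω C₁ N) {A : ℝ} {J : ℕ}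
    (hJ : A + 1 ≤ 2 ^ J) {x X Y : Rn n} {r : ℝ} (hx : x ∈ bdry Ω) (hr : 0 < r) (hX : X ∈ Ω)
    (hXx : dist X x ≤ A * δ Ω X) (hrX : r < δ Ω X) (hXr : δ Ω X ≤ 2 * r)
    (ha : Adm Ω (2 ^ J * r)) (hY : Cork Ω C₁ x (2 ^ J * r) Y) : Chain Ω (N + J * N + N) X Y := by
  have hC := h1.1
  obtain ⟨y, hy, hXy⟩ := (isClosed_frontier : IsClosed (bdry Ω)).exists_infDist_eq_dist ⟨x, hx⟩ X
  change δ Ω X = dist X y at hXy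
  -- Climb from `X` through corkscrew points above its nearest boundary point `y`, doubling the
  -- scale until `2 ^ J * r` is comparable to `|x-y|`; a single chain then leads sideways to the
  -- corkscrew point of `x`.
  have up : ∀ j ≤ J, ∃ P, Cork Ω C₁ y (2 ^ j * r) P ∧ Chain Ω (N + j * N) X P := by
    intro j
    induction j with
    | zero =>
      intro _
      have hle : (2 : ℝ) ^ 0 * r ≤ 2 ^ J * r := by gcongr; simp
      obtain ⟨P, hP⟩ := h1.exists_cork hy (by positivity) (ha.mono hle)
      refine ⟨P, hP, ?_⟩
      rw [pow_zero, one_mul] at hP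
      rw [zero_mul, add_zero]
      -- `C₁ ≥ 1` is not assumed; the existence of a corkscrew point itself forces `3/4 * C₁⁻¹ < 1`.
      have hPr : 3 / 4 * (C₁⁻¹ * r) < r := hP.2.2.trans_le ((delta_le_dist hy P).trans hP.2.1.le)
      refine h2.chain (r := 3 / 4 * (C₁⁻¹ * r)) (by positivity) hX hP.1 (hPr.trans hrX) hP.2.2 ?_
      have h := dist_triangle_right X P y
      rw [show 7 * C₁ * (3 / 4 * (C₁⁻¹ * r)) = 21 / 4 * r by field_simp; norm_num]
      linarith [hP.2.1]
    | succ j ih =>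
      intro hj
      obtain ⟨P, hP, hXP⟩ := ih (by omega)
      have hle : (2 : ℝ) ^ (j + 1) * r ≤ 2 ^ J * r := by
        gcongr
        exact one_le_two
      obtain ⟨Q, hQ⟩ := h1.exists_cork hy (by positivity) (ha.mono hle)
      refine ⟨Q, hQ, ?_⟩
      have := hXP.trans (cork_chain_double hC h2 (by positivity) hP
        (by rwa [← mul_assoc, ← pow_succ']))
      convert this using 1
      ring
  obtain ⟨P, hP, hXP⟩ := up J le_rfl
  refine hXP.trans (cork_chain_near hC h2 (by positivity) ?_ hP hY)
  have h := dist_triangle_left y x X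
  have : (A + 1) * δ Ω X ≤ 2 ^ J * (2 * r) := by
    have := delta_nonneg (Ω := Ω) X
    gcongr
  linarith

/-- The summand `1` lets the same constant also serve in `dist X x ≤ A * r`. -/
lemma Cork.le_mul_delta {C₁ : ℝ} (hC : 0 < C₁) {x X : Rn n} {r : ℝ} (h : Cork Ω C₁ x r X) :
    r ≤ (1 + 4 / 3 * C₁) * δ Ω X := by
  have := h.2.2
  have h0 : 0 ≤ δ Ω X := delta_nonneg X
  have h2 : 4 / 3 * C₁ * (3 / 4 * (C₁⁻¹ * r)) ≤ 4 / 3 * C₁ * δ Ω X := by gcongr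
  have h3 : 4 / 3 * C₁ * (3 / 4 * (C₁⁻¹ * r)) = r := by field_simp
  linarith

/-- The averages of `u` near comparable corkscrew points. -/
lemma exists_osc_cork {C₁ : ℝ} (hC : 0 < C₁) {N : ℕ} (h2 : H2 Ω C₁ N) {C₄ : ℝ≥0} (h4 : H4 Ω m C₄)
    (hΓ : (bdry Ω).Nonempty) (K : ℝ) (hK : 0 ≤ K) :
    ∃ M, 0 < M ∧ ∀ (u : Rn n → ℝ) (F : Rn n → ℝ≥0∞), HasPoincare Ω m K u F →
      ∀ (x X : Rn n) (r : ℝ), x ∈ bdry Ω → 0 < r → Cork Ω C₁ x r X →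
        (∀ Y, Cork Ω C₁ x (r / 2) Y → |avg Ω m u X - avg Ω m u Y| ≤ oscBound Ω m F M x r) ∧
        ∀ y Y, dist x y ≤ 2 * r → Cork Ω C₁ y r Y →
          |avg Ω m u X - avg Ω m u Y| ≤ oscBound Ω m F M x r := by
  obtain ⟨M, hM, h⟩ := exists_osc_chain h4 hΓ K hK N (1 + 4 / 3 * C₁) (by positivity)
  refine ⟨M, hM, fun u F hu x X r hx hr hX => ⟨fun Y hY => ?_, fun y Y hxy hY => ?_⟩⟩
  · refine h u F hu x X Y r hx hr (cork_chain_half hC h2 hr hX hY) ?_ (hX.le_mul_delta hC)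
    have : 0 < C₁ * r := by positivity
    linarith [hX.2.1]
  · refine h u F hu x X Y r hx hr (cork_chain_near hC h2 hr hxy hX hY) ?_ (hX.le_mul_delta hC)
    have : 0 < C₁ * r := by positivity
    linarith [hX.2.1]

/-- The averages of `u` near a point of a nontangential cone and near a corkscrew point. -/
lemma exists_osc_nontangential {C₁ : ℝ} (h1 : H1 Ω C₁) {N : ℕ} (h2 : H2 Ω C₁ N) {C₄ : ℝ≥0}
    (h4 : H4 Ω m C₄) (hΓ : (bdry Ω).Nonempty) (K A : ℝ) (hK : 0 ≤ K) (hA : 0 < A) :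
    ∃ (M : ℝ) (J : ℕ), 0 < M ∧ ∀ (u : Rn n → ℝ) (F : Rn n → ℝ≥0∞), HasPoincare Ω m K u F →
      ∀ (x X Y : Rn n) (r : ℝ), x ∈ bdry Ω → 0 < r → X ∈ Ω → dist X x ≤ A * δ Ω X →
        r < δ Ω X → δ Ω X ≤ 2 * r → Adm Ω (2 ^ J * r) → Cork Ω C₁ x (2 ^ J * r) Y →
        |avg Ω m u X - avg Ω m u Y| ≤ oscBound Ω m F M x (2 ^ J * r) ∧
        ⨍ Z in ball X (δ Ω X / 2), |u Z - avg Ω m u X| ∂m ≤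
          oscBound Ω m F M x (2 ^ J * r) := by
  obtain ⟨J, hJ⟩ := pow_unbounded_of_one_lt (A + 1) one_lt_two
  obtain ⟨M, hM, h⟩ := exists_osc_chain h4 hΓ K hK (N + J * N + N) (2 * A + 2 ^ J) (by positivity)
  obtain ⟨M', hM', h'⟩ := exists_osc_self h4 hΓ K (2 * A + 2 ^ J) hK (by positivity)
  refine ⟨M + M', J, by positivity, fun u F hu x X Y r hx hr hX hXx hrX hXr ha hY => ?_⟩
  have hR : 0 < 2 ^ J * r := by positivity
  have hJ1 : (1 : ℝ) ≤ 2 ^ J := one_le_pow₀ one_le_two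
  have e1 : dist X x ≤ (2 * A + 2 ^ J) * (2 ^ J * r) := by
    calc dist X x ≤ A * (2 * r) := hXx.trans (by gcongr)
      _ = 2 * A * (1 * r) + 0 := by ring
      _ ≤ 2 * A * (2 ^ J * r) + 2 ^ J * (2 ^ J * r) := by gcongr; positivity
      _ = _ := by ring
  have e2 : 2 ^ J * r ≤ (2 * A + 2 ^ J) * δ Ω X := by
    have : 0 < A * δ Ω X := mul_pos hA (hr.trans hrX)
    have : (2 : ℝ) ^ J * r ≤ 2 ^ J * δ Ω X := by gcongr
    linarith
  exact ⟨(h u F hu x X Y _ hx hR (nontangential_chain h1 h2 hJ.le hx hr hX hXx hrX hXr ha hY)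
      e1 e2).trans (hu.oscBound_mono hM.le (by linarith) x hR),
    (h' u F hu x X _ hx hR hX e1 e2).trans (hu.oscBound_mono hM'.le (by linarith) x hR)⟩

/-! ### The square function -/

/-- The energy in the shadow of scale `2⁻ᵏ`, divided by the measure of the boundary ball. -/
noncomputable def shadowEnergy (Ω : TopologicalSpace.Opens (Rn n)) (m μ : Measure (Rn n))
    (F : Rn n → ℝ≥0∞) (M : ℝ) (k : ℤ) (x : Rn n) : ℝ≥0∞ :=
  (μ (ball x (2 ^ (-k))))⁻¹ * ∫⁻ Z in shadow Ω M x (2 ^ (-k)), F Z ∂m.restrict Ω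

lemma measurableSet_shadow_prod (M r : ℝ) :
    MeasurableSet {p : Rn n × Rn n | p.2 ∈ shadow Ω M p.1 r} := by
  have hc := continuous_delta (Ω := Ω)
  refine MeasurableSet.inter (s₁ := {p : Rn n × Rn n | dist p.2 p.1 < M * r})
    (s₂ := {p : Rn n × Rn n | r < M * δ Ω p.2}) ?_ ?_
  · exact (isOpen_lt (by fun_prop) (by fun_prop)).measurableSet
  · exact (isOpen_lt (by fun_prop) (by fun_prop)).measurableSet

lemma measurableSet_shadow (M : ℝ) (x : Rn n) (r : ℝ) : MeasurableSet (shadow Ω M x r) :=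
  measurable_prodMk_left (x := x) (measurableSet_shadow_prod (Ω := Ω) M r)

lemma measurable_inv_measure_ball (μ : Measure (Rn n)) (r : ℝ) :
    Measurable fun x => (μ (ball x r))⁻¹ :=
  ((measurable_measure_ball μ).comp (measurable_id.prodMk measurable_const)).inv

lemma measurable_shadow_indicator {F : Rn n → ℝ≥0∞} (hF : Measurable F) (M r : ℝ) :
    Measurable fun p : Rn n × Rn n => (shadow Ω M p.1 r).indicator F p.2 := by
  have : (fun p : Rn n × Rn n => (shadow Ω M p.1 r).indicator F p.2) =
      {p : Rn n × Rn n | p.2 ∈ shadow Ω M p.1 r}.indicator fun p => F p.2 := by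
    ext p
    by_cases hp : p.2 ∈ shadow Ω M p.1 r
    · rw [Set.indicator_of_mem hp, Set.indicator_of_mem (by exact hp)]
    · rw [Set.indicator_of_notMem hp, Set.indicator_of_notMem (by exact hp)]
  rw [this]
  exact (hF.comp measurable_snd).indicator (measurableSet_shadow_prod M r)

lemma measurable_shadowEnergy [SFinite (m.restrict (Ω : Set (Rn n)))] {F : Rn n → ℝ≥0∞}
    (hF : Measurable F) (M : ℝ) (k : ℤ) : Measurable (shadowEnergy Ω m μ F M k) := by
  refine (measurable_inv_measure_ball μ _).mul ?_
  simp_rw [← lintegral_indicator (measurableSet_shadow M _ _)]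
  exact (measurable_shadow_indicator hF M _).lintegral_prod_right'

/-- For fixed `Z`, the boundary points whose shadow contains `Z` carry bounded mass. -/
lemma H3.lintegral_shadow_le [IsLocallyFiniteMeasure μ] {C₃ : ℝ≥0} (h3 : H3 Ω μ C₃) {M : ℝ}
    {p : ℕ} (hp : 2 * M ≤ 2 ^ p) (F : Rn n → ℝ≥0∞) (Z : Rn n) {r : ℝ} (hr : 0 < r) :
    ∫⁻ x, (μ (ball x r))⁻¹ * (shadow Ω M x r).indicator F Z ∂μ ≤ (C₃ : ℝ≥0∞) ^ p * F Z := by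
  -- Every `x` whose shadow contains `Z` lies in this ball, and `B(x, 2Mr)` contains the ball, so by
  -- doubling `μ(B(x,r))⁻¹ ≤ C₃ ^ p / b` there.
  set b := μ (ball Z (M * r)) with hb
  calc ∫⁻ x, (μ (ball x r))⁻¹ * (shadow Ω M x r).indicator F Z ∂μ
      ≤ ∫⁻ x, (ball Z (M * r)).indicator (fun _ => b⁻¹ * ((C₃ : ℝ≥0∞) ^ p * F Z)) x ∂μ := by
        refine lintegral_mono_ae ?_
        filter_upwards [h3.ae_mem_bdry] with x hx
        by_cases hZ : Z ∈ shadow Ω M x r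
        · have hxZ : x ∈ ball Z (M * r) := by
            rw [mem_ball, dist_comm]
            exact hZ.1
          rw [Set.indicator_of_mem hZ, Set.indicator_of_mem hxZ, ← mul_assoc]
          gcongr
          have hb0 : b ≠ 0 := by
            have := hx
            rw [← h3.1] at this
            exact ((Measure.mem_support_iff_forall x).1 this _ (isOpen_ball.mem_nhds hxZ)).ne'
          have hbt : b ≠ ⊤ := measure_ball_lt_top.ne
          have hle : b ≤ (C₃ : ℝ≥0∞) ^ p * μ (ball x r) := by
            refine h3.measure_ball_le hx hr p ?_
            have : 2 * M * r ≤ 2 ^ p * r := by gcongr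
            linarith [hZ.1]
          calc (μ (ball x r))⁻¹ = b⁻¹ * (b / μ (ball x r)) := by
                rw [div_eq_mul_inv, ← mul_assoc, ENNReal.inv_mul_cancel hb0 hbt, one_mul]
            _ ≤ b⁻¹ * (C₃ : ℝ≥0∞) ^ p := by
                gcongr
                exact ENNReal.div_le_of_le_mul hle
        · rw [Set.indicator_of_notMem hZ, mul_zero]
          exact zero_le
    _ = b⁻¹ * b * ((C₃ : ℝ≥0∞) ^ p * F Z) := by
        rw [lintegral_indicator_const measurableSet_ball]
        ring
    _ ≤ 1 * ((C₃ : ℝ≥0∞) ^ p * F Z) := by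
        gcongr
        exact ENNReal.inv_mul_le_one _
    _ = _ := one_mul _

/-- The shadows that contain a given point have boundedly many scales. -/
lemma exists_finset_scales {M : ℝ} {q : ℕ} (hq : M ≤ 2 ^ q) (Z : Rn n) :
    ∃ s : Finset ℤ, s.card ≤ 2 * q ∧ ∀ k ∉ s, ∀ x ∈ bdry Ω, Z ∉ shadow Ω M x (2 ^ (-k)) := by
  rcases (delta_nonneg (Ω := Ω) Z).eq_or_lt with h0 | h0
  · refine ⟨∅, by simp, fun k _ x _ hZ => ?_⟩
    have h1 := hZ.2
    rw [← h0, mul_zero] at h1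
    exact absurd h1 (by positivity : (0 : ℝ) < 2 ^ (-k)).le.not_gt
  · obtain ⟨a, ha1, ha2⟩ := exists_mem_Ioc_zpow h0 one_lt_two
    -- With `2^a < δ(Z) ≤ 2^(a+1)`, the two conditions of the shadow give `2^(-k) < 2^(q+a+1)` and
    -- `2^a < 2^(q-k)`. The open interval contains exactly `2 * q` integers.
    refine ⟨Finset.Ioo (-q - a - 1) (q - a), ?_, fun k hk x hx hZ => hk ?_⟩
    · rw [Int.card_Ioo]
      omega
    · rw [Finset.mem_Ioo]
      have two : (1 : ℝ) < 2 := one_lt_two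
      constructor
      · have : (2 : ℝ) ^ (-k) < 2 ^ ((q : ℤ) + (a + 1)) := by
          rw [zpow_add₀ two_ne_zero, zpow_natCast]
          exact hZ.2.trans_le (by gcongr)
        have := (zpow_lt_zpow_iff_right₀ two).1 this
        omega
      · have : (2 : ℝ) ^ a < 2 ^ ((q : ℤ) + (-k)) := by
          rw [zpow_add₀ two_ne_zero, zpow_natCast]
          calc (2 : ℝ) ^ a < δ Ω Z := ha1
            _ ≤ dist Z x := delta_le_dist hx Z
            _ < M * 2 ^ (-k) := hZ.1
            _ ≤ _ := by gcongr
        have := (zpow_lt_zpow_iff_right₀ two).1 this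
        omega

/-- The square function estimate. After Tonelli, each `Z` is counted at no more than `2 * p` scales,
and at each of them with total weight at most `C₃ ^ p`. -/
lemma H3.exists_tsum_shadowEnergy_le [IsLocallyFiniteMeasure μ] {C₃ : ℝ≥0} (h3 : H3 Ω μ C₃)
    [SFinite (m.restrict (Ω : Set (Rn n)))] {M : ℝ} (hM : 0 < M) :
    ∃ C : ℝ≥0, ∀ F : Rn n → ℝ≥0∞, Measurable F →
      ∑' k : ℤ, ∫⁻ x, shadowEnergy Ω m μ F M k x ∂μ ≤ C * ∫⁻ Z, F Z ∂m.restrict Ω := by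
  obtain ⟨p, hp⟩ := pow_unbounded_of_one_lt (2 * M) one_lt_two
  refine ⟨(2 * p : ℕ) * C₃ ^ p, fun F hF => ?_⟩
  have hmeas : ∀ k : ℤ, Measurable fun q : Rn n × Rn n => (μ (ball q.1 (2 ^ (-k))))⁻¹ *
      (shadow Ω M q.1 (2 ^ (-k))).indicator F q.2 := fun k =>
    ((measurable_inv_measure_ball μ _).comp measurable_fst).mul (measurable_shadow_indicator hF M _)
  have swap : ∀ k : ℤ, ∫⁻ x, shadowEnergy Ω m μ F M k x ∂μ = ∫⁻ Z, ∫⁻ x,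
      (μ (ball x (2 ^ (-k))))⁻¹ * (shadow Ω M x (2 ^ (-k))).indicator F Z ∂μ ∂m.restrict Ω := by
    intro k
    rw [← lintegral_lintegral_swap (hmeas k).aemeasurable]
    refine lintegral_congr fun x => ?_
    rw [shadowEnergy, ← lintegral_indicator (measurableSet_shadow M _ _), lintegral_const_mul]
    exact hF.indicator (measurableSet_shadow M _ _)
  simp_rw [swap]
  rw [← lintegral_tsum fun k => (hmeas k).lintegral_prod_left'.aemeasurable,
    ← lintegral_const_mul _ hF]
  refine lintegral_mono fun Z => ?_
  obtain ⟨s, hs, hZ⟩ := exists_finset_scales (Ω := Ω) (M := M) (q := p) (by linarith) Z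
  rw [tsum_eq_sum (s := s)]
  · calc _ ≤ ∑ k ∈ s, (C₃ : ℝ≥0∞) ^ p * F Z :=
          Finset.sum_le_sum fun k _ => h3.lintegral_shadow_le hp.le F Z (by positivity)
      _ = s.card * ((C₃ : ℝ≥0∞) ^ p * F Z) := by rw [Finset.sum_const, nsmul_eq_mul]
      _ ≤ (2 * p : ℕ) * ((C₃ : ℝ≥0∞) ^ p * F Z) := by gcongr
      _ = _ := by push_cast; ring
  · intro k hk
    refine (lintegral_congr_ae ?_).trans lintegral_zero
    filter_upwards [h3.ae_mem_bdry] with x hx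
    rw [Set.indicator_of_notMem (hZ k hk x hx), mul_zero]

/-! ### Sequences with controlled increments -/

/-- By the inequality of arithmetic and geometric means the increments are at most `q i + S i`,
which is summable. -/
lemma exists_tendsto_of_increments {a q : ℕ → ℝ} {S : ℕ → ℝ≥0∞} (hq : ∀ i, 0 ≤ q i)
    (hqs : Summable q) (hS : ∑' i, S i ≠ ⊤)
    (h : ∀ i, |a i - a (i + 1)| ≤ √(q i) * √(S i).toReal) :
    ∃ g, Tendsto a atTop (𝓝 g) := by
  refine cauchySeq_tendsto_of_complete (cauchySeq_of_dist_le_of_summable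
    (fun i => q i + (S i).toReal) (fun i => ?_) (hqs.add (ENNReal.summable_toReal hS)))
  rw [Real.dist_eq]
  refine (h i).trans ?_
  have h1 := Real.sq_sqrt (hq i)
  have h2 := Real.sq_sqrt (ENNReal.toReal_nonneg (a := S i))
  nlinarith [sq_nonneg (√(q i) - √(S i).toReal), sq_nonneg (√(q i)), sq_nonneg (√(S i).toReal)]

/-- Cauchy–Schwarz with the weight `σ^(2i)` split evenly: one factor `σ^i` is summed as a geometric
series, the other stays with `S i`. The remaining decay is what makes the later sum over all
starting scales converge. -/
lemma ofReal_sq_sub_limit_le {a : ℕ → ℝ} {S : ℕ → ℝ≥0∞} {Q σ g : ℝ} (hQ : 0 ≤ Q) (hσ : 0 ≤ σ)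
    (hσ1 : σ < 1) (hS : ∀ i, S i ≠ ⊤) (ha : Tendsto a atTop (𝓝 g))
    (h : ∀ i, |a i - a (i + 1)| ≤ √(Q * (σ ^ i * σ ^ i)) * √(S i).toReal) :
    ENNReal.ofReal (|a 0 - g| ^ 2) ≤
      ENNReal.ofReal (Q / (1 - σ)) * ∑' i, ENNReal.ofReal σ ^ i * S i := by
  have h1σ : 0 < 1 - σ := by linarith
  have key : ∀ k, ENNReal.ofReal (|a 0 - a k| ^ 2) ≤
      ENNReal.ofReal (Q / (1 - σ)) * ∑' i, ENNReal.ofReal σ ^ i * S i := by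
    intro k
    have e1 : |a 0 - a k| ≤ ∑ i ∈ Finset.range k, √(Q * σ ^ i) * √(σ ^ i * (S i).toReal) := by
      rw [← Real.dist_eq]
      refine (dist_le_range_sum_dist a k).trans (Finset.sum_le_sum fun i _ => ?_)
      rw [Real.dist_eq]
      refine (h i).trans_eq ?_
      rw [← Real.sqrt_mul (by positivity), ← Real.sqrt_mul (by positivity)]
      congr 1
      ring
    have e2 := e1.trans (Real.sum_sqrt_mul_sqrt_le (Finset.range k)
      (f := fun i => Q * σ ^ i) (g := fun i => σ ^ i * (S i).toReal)
      (fun i => by positivity) (fun i => by positivity))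
    have e3 : ∑ i ∈ Finset.range k, Q * σ ^ i ≤ Q / (1 - σ) := by
      rw [← Finset.mul_sum, div_eq_mul_inv, ← tsum_geometric_of_lt_one hσ hσ1]
      gcongr
      exact (summable_geometric_of_lt_one hσ hσ1).sum_le_tsum _ fun i _ => by positivity
    have e4 : |a 0 - a k| ^ 2 ≤
        Q / (1 - σ) * ∑ i ∈ Finset.range k, σ ^ i * (S i).toReal := by
      calc |a 0 - a k| ^ 2 ≤ (√(∑ i ∈ Finset.range k, Q * σ ^ i) *
            √(∑ i ∈ Finset.range k, σ ^ i * (S i).toReal)) ^ 2 := by gcongr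
        _ = (∑ i ∈ Finset.range k, Q * σ ^ i) * ∑ i ∈ Finset.range k, σ ^ i * (S i).toReal := by
            rw [mul_pow, Real.sq_sqrt (Finset.sum_nonneg fun i _ => by positivity),
              Real.sq_sqrt (Finset.sum_nonneg fun i _ => by positivity)]
        _ ≤ _ := by
            gcongr
    refine (ENNReal.ofReal_le_ofReal e4).trans ?_
    rw [ENNReal.ofReal_mul (by positivity)]
    gcongr
    rw [ENNReal.ofReal_sum_of_nonneg fun i _ => by positivity]
    refine le_trans (Finset.sum_le_sum fun i _ => ?_) (ENNReal.sum_le_tsum (Finset.range k))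
    rw [ENNReal.ofReal_mul (by positivity), ENNReal.ofReal_pow hσ, ENNReal.ofReal_toReal (hS i)]
  refine le_of_tendsto' (x := atTop) (f := fun k => ENNReal.ofReal (|a 0 - a k| ^ 2)) ?_ key
  exact ENNReal.tendsto_ofReal (((ha.const_sub _).abs).pow 2)

/-! ### The weights of the dyadic scales -/

/-- `r / ρ(x,r)` for `r = 2⁻ᵏ`. -/
noncomputable def scaleRatio (Ω : TopologicalSpace.Opens (Rn n)) (m μ : Measure (Rn n)) (k : ℤ)
    (x : Rn n) : ℝ :=
  (2 ^ (-k)) ^ 2 * μ.real (ball x (2 ^ (-k))) / mBall Ω m x (2 ^ (-k))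

lemma scaleRatio_nonneg (k : ℤ) (x : Rn n) : 0 ≤ scaleRatio Ω m μ k x := by
  unfold scaleRatio mBall
  positivity

/-- The ratio of the two sides' weights is `(s/r) ρ(x,r)/ρ(x,s)`, and (H5) bounds it by `C₅ (s/r)^ε`
with `s/r = 2⁻ⁱ`. The maximum with `1` covers `i = 0`, where (H5) says nothing. -/
lemma H5.scaleRatio_le [IsLocallyFiniteMeasure μ] {C₃ C₄ : ℝ≥0} {C₅ : ℝ} (h3 : H3 Ω μ C₃)
    (h4 : H4 Ω m C₄) (h5 : H5 Ω m μ C₅) {x : Rn n} (hx : x ∈ bdry Ω) (k : ℤ) (i : ℕ) :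
    scaleRatio Ω m μ (k + i) x ≤
      max C₅ 1 * ((2 : ℝ) ^ (-C₅⁻¹)) ^ i * scaleRatio Ω m μ k x := by
  have hxc := bdry_subset_closure hx
  rcases Nat.eq_zero_or_pos i with rfl | hi
  · simp only [Nat.cast_zero, add_zero, pow_zero, mul_one]
    exact le_mul_of_one_le_left (scaleRatio_nonneg k x) (le_max_right _ _)
  set r : ℝ := 2 ^ (-k) with hr
  set s : ℝ := 2 ^ (-(k + i)) with hs
  have hr0 : 0 < r := by positivity
  have hs0 : 0 < s := by positivity
  have hrs : r / s = 2 ^ i := by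
    rw [hr, hs, ← zpow_sub₀ two_ne_zero, ← zpow_natCast]
    congr 1
    ring
  have hsr : s < r := by
    rw [hr, hs]
    exact zpow_lt_zpow_right₀ one_lt_two (by omega)
  have h := h5.2 x hx s r hs0 hsr
  have m1 := h4.mBall_pos hxc hr0
  have m2 := h4.mBall_pos hxc hs0
  have μ1 := h3.muBall_pos hx hr0
  have μ2 := h3.muBall_pos hx hs0
  have eq : scaleRatio Ω m μ (k + i) x =
      (s / r) * (rho Ω m μ x r / rho Ω m μ x s) * scaleRatio Ω m μ k x := by
    unfold scaleRatio rho
    rw [← hr, ← hs]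
    field_simp
  have pw : s / r * (r / s) ^ (1 - C₅⁻¹) = ((2 : ℝ) ^ (-C₅⁻¹)) ^ i := by
    have : s / r = (r / s)⁻¹ := by rw [inv_div]
    have h2 : (0 : ℝ) < 2 ^ i := by positivity
    rw [this, hrs, sub_eq_add_neg, Real.rpow_add h2, Real.rpow_one, inv_mul_cancel_left₀ h2.ne',
      ← Real.rpow_natCast, ← Real.rpow_natCast, ← Real.rpow_mul two_pos.le,
      ← Real.rpow_mul two_pos.le, mul_comm]
  rw [eq]
  have hρ := scaleRatio_nonneg (Ω := Ω) (m := m) (μ := μ) k x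
  refine mul_le_mul_of_nonneg_right ?_ hρ
  calc s / r * (rho Ω m μ x r / rho Ω m μ x s) ≤ s / r * (C₅ * (r / s) ^ (1 - C₅⁻¹)) := by gcongr
    _ = C₅ * ((2 : ℝ) ^ (-C₅⁻¹)) ^ i := by rw [← pw]; ring
    _ ≤ _ := by
      gcongr
      exact le_max_left _ _

lemma oscBound_eq [IsLocallyFiniteMeasure μ] {C₃ C₄ : ℝ≥0} (h3 : H3 Ω μ C₃) (h4 : H4 Ω m C₄)
    (F : Rn n → ℝ≥0∞) {M : ℝ} (hM : 0 ≤ M) {x : Rn n} (hx : x ∈ bdry Ω) (k : ℤ) :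
    oscBound Ω m F M x (2 ^ (-k)) =
      √(M ^ 2 * scaleRatio Ω m μ k x) * √(shadowEnergy Ω m μ F M k x).toReal := by
  have hr : (0 : ℝ) < 2 ^ (-k) := by positivity
  have m1 := h4.mBall_pos (bdry_subset_closure hx) hr
  have μ1 := h3.muBall_pos hx hr
  unfold oscBound shadowEnergy scaleRatio
  set r : ℝ := 2 ^ (-k)
  rw [ENNReal.toReal_mul, ENNReal.toReal_inv]
  change _ = _ * √((μ.real (ball x r))⁻¹ * _)
  set e := (∫⁻ Z in shadow Ω M x r, F Z ∂m.restrict Ω).toReal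
  have he : 0 ≤ e := ENNReal.toReal_nonneg
  rw [← Real.sqrt_mul (by positivity), ← Real.sqrt_sq (by positivity : 0 ≤ M * r),
    ← Real.sqrt_div (by positivity), ← Real.sqrt_mul (by positivity)]
  congr 1
  field_simp

/-- At equal centers and radii the cancellation is exact: `(ρ²/m) (r/ρ) = ρ r/m = 1/μ(B)`. Doubling
pays for `dist x y` against `2⁻ᵏ` and for moving the center; later `z` is `x` or `y`. -/
lemma hKer_mul_scaleRatio_le [IsLocallyFiniteMeasure μ] {C₃ C₄ : ℝ≥0} (h3 : H3 Ω μ C₃)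
    (h4 : H4 Ω m C₄) {x y z : Rn n} (hx : x ∈ bdry Ω) (hz : z ∈ bdry Ω) {k : ℤ}
    (h1 : 2 ^ (-k) < dist x y) (h2 : dist x y ≤ 2 * 2 ^ (-k)) (hxz : dist x z ≤ dist x y) :
    hKer Ω m μ x y * scaleRatio Ω m μ k z ≤
      (C₄ : ℝ) ^ 2 * (C₃ : ℝ) ^ 2 * (μ.real (ball z (2 ^ (-k))))⁻¹ := by
  unfold hKer scaleRatio rho
  set r : ℝ := 2 ^ (-k)
  set d := dist x y
  have hr : 0 < r := by positivity
  have hd : 0 < d := hr.trans h1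
  have m1 := h4.mBall_pos (bdry_subset_closure hx) hd
  have m2 := h4.mBall_pos (bdry_subset_closure hz) hr
  have μ1 := h3.muBall_pos hx hd
  have μ2 := h3.muBall_pos hz hr
  have e1 : mBall Ω m x d ≤ (C₄ : ℝ) ^ 2 * mBall Ω m z r :=
    h4.mBall_le_mBall (bdry_subset_closure hz) hr 2 (by linarith)
  have e2 : μ.real (ball z r) ≤ (C₃ : ℝ) ^ 1 * μ.real (ball x d) :=
    h3.muBall_le hx hd 1 (by rw [dist_comm z x]; linarith)
  rw [pow_one] at e2
  set a := mBall Ω m x d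
  set b := mBall Ω m z r
  set c := μ.real (ball x d)
  set e := μ.real (ball z r)
  have eq : (a / (d * c)) ^ 2 / a * (r ^ 2 * e / b) = (a / b) * (r / d) ^ 2 * (e / c) ^ 2 * e⁻¹ := by
    field_simp
  rw [eq]
  have f1 : a / b ≤ (C₄ : ℝ) ^ 2 := by rwa [div_le_iff₀ m2]
  have f2 : e / c ≤ C₃ := by rwa [div_le_iff₀ μ1]
  have f3 : (r / d) ^ 2 ≤ 1 := pow_le_one₀ (by positivity) (by rw [div_le_one hd]; exact h1.le)
  calc _ ≤ (C₄ : ℝ) ^ 2 * 1 * (C₃ : ℝ) ^ 2 * e⁻¹ := by gcongr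
    _ = _ := by ring

/-! ### From pointwise bounds to the energy -/

/-- For each fixed `i` the sum over all `k` is invariant under the shift by `i`, so only the
geometric series in `q` remains. -/
lemma tsum_lintegral_tail {ν : Measure (Rn n)} {S : ℤ → Rn n → ℝ≥0∞} (hS : ∀ k, Measurable (S k))
    (q : ℝ≥0∞) :
    ∑' k, ∫⁻ x, ∑' i : ℕ, q ^ i * S (k + i) x ∂ν = (1 - q)⁻¹ * ∑' k, ∫⁻ x, S k x ∂ν := by
  have h1 : ∀ k : ℤ, ∫⁻ x, ∑' i : ℕ, q ^ i * S (k + i) x ∂ν =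
      ∑' i : ℕ, q ^ i * ∫⁻ x, S (k + i) x ∂ν := fun k => by
    rw [lintegral_tsum fun i => ((hS _).const_mul _).aemeasurable]
    exact tsum_congr fun i => lintegral_const_mul _ (hS _)
  simp_rw [h1]
  rw [ENNReal.tsum_comm, ← ENNReal.tsum_geometric, ← ENNReal.tsum_mul_right]
  refine tsum_congr fun i => ?_
  rw [ENNReal.tsum_mul_left]
  congr 1
  exact (Equiv.addRight (i : ℤ)).tsum_eq fun k => ∫⁻ x, S k x ∂ν

/-- The inner integrand is constant in `y`, so only the measure of the closed ball of radius `2r`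
counts. It sits in the open ball of radius `4r`, hence two doublings. -/
lemma H3.lintegral_annulus_le [IsLocallyFiniteMeasure μ] {C₃ : ℝ≥0} (h3 : H3 Ω μ C₃)
    (R : Rn n → ℝ≥0∞) {r : ℝ} (hr : 0 < r) :
    ∫⁻ x, ∫⁻ y, {y | dist x y ≤ 2 * r}.indicator
      (fun _ => (μ (ball x r))⁻¹ * R x) y ∂μ ∂μ ≤ (C₃ : ℝ≥0∞) ^ 2 * ∫⁻ x, R x ∂μ := by
  rw [← lintegral_const_mul' _ _ (by finiteness)]
  refine lintegral_mono_ae ?_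
  filter_upwards [h3.ae_mem_bdry] with x hx
  rw [lintegral_indicator_const (measurableSet_le (by fun_prop) (by fun_prop))]
  have hle : μ {y | dist x y ≤ 2 * r} ≤ (C₃ : ℝ≥0∞) ^ 2 * μ (ball x r) := by
    refine (measure_mono fun y hy => ?_).trans (h3.measure_ball_two_pow_le hx hr 2)
    rw [Set.mem_ofPred_eq, dist_comm] at hy
    rw [mem_ball]
    linarith
  calc _ ≤ (μ (ball x r))⁻¹ * R x * ((C₃ : ℝ≥0∞) ^ 2 * μ (ball x r)) := by gcongr
    _ = (μ (ball x r))⁻¹ * μ (ball x r) * ((C₃ : ℝ≥0∞) ^ 2 * R x) := by ring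
    _ ≤ 1 * ((C₃ : ℝ≥0∞) ^ 2 * R x) := by
      gcongr
      exact ENNReal.inv_mul_le_one _
    _ = _ := one_mul _

lemma lintegral_const_mul_tsum_add {ν : Measure (Rn n)} (C : ℝ≥0∞) {f g : ℤ → Rn n → ℝ≥0∞}
    (hf : ∀ k, Measurable (f k)) (hg : ∀ k, Measurable (g k)) :
    ∫⁻ x, C * ∑' k, (f k x + g k x) ∂ν = C * ∑' k, (∫⁻ x, f k x ∂ν + ∫⁻ x, g k x ∂ν) := by
  have h : ∀ k, Measurable fun x => f k x + g k x := fun k => (hf k).add (hg k)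
  rw [lintegral_const_mul _ (Measurable.tsum h), lintegral_tsum fun k => (h k).aemeasurable]
  congr 1
  exact tsum_congr fun k => lintegral_add_left (hf k) _

/-- Pairs `x ≠ y` are sorted by the dyadic size of their distance. The term based at `y` becomes the
one based at `x` after exchanging the integrals, whence the factor `2`. -/
lemma H3.hEnergy_le_of_pointwise [IsLocallyFiniteMeasure μ] {C₃ : ℝ≥0} (h3 : H3 Ω μ C₃)
    {R : ℤ → Rn n → ℝ≥0∞} (hR : ∀ k, Measurable (R k)) {g : Rn n → ℝ} {C : ℝ≥0∞}
    {P : Rn n → Prop} (hP : ∀ᵐ x ∂μ, P x)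
    (h : ∀ x y, P x → P y → ∀ k : ℤ, 2 ^ (-k) < dist x y → dist x y ≤ 2 * 2 ^ (-k) →
      ENNReal.ofReal (hKer Ω m μ x y * |g x - g y| ^ 2) ≤
        C * ((μ (ball x (2 ^ (-k))))⁻¹ * R k x + (μ (ball y (2 ^ (-k))))⁻¹ * R k y)) :
    hEnergy Ω m μ g ≤ C * (2 * ((C₃ : ℝ≥0∞) ^ 2 * ∑' k, ∫⁻ x, R k x ∂μ)) := by
  obtain ⟨T, hT⟩ : ∃ T : ℤ → Rn n → Rn n → ℝ≥0∞, ∀ k x y, T k x y =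
      {y | dist x y ≤ 2 * 2 ^ (-k)}.indicator (fun _ => (μ (ball x (2 ^ (-k))))⁻¹ * R k x) y :=
    ⟨_, fun _ _ _ => rfl⟩
  have hTm : ∀ k, Measurable fun p : Rn n × Rn n => T k p.1 p.2 := by
    intro k
    have : (fun p : Rn n × Rn n => T k p.1 p.2) =
        {p : Rn n × Rn n | dist p.1 p.2 ≤ 2 * 2 ^ (-k)}.indicator
          fun p => (μ (ball p.1 (2 ^ (-k))))⁻¹ * R k p.1 := by
      ext p
      simp only [hT, Set.indicator, Set.mem_ofPred_eq]
    rw [this]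
    exact (((measurable_inv_measure_ball μ _).mul (hR k)).comp measurable_fst).indicator
      (measurableSet_le (by fun_prop) (by fun_prop))
  have hTm' : ∀ k, Measurable fun p : Rn n × Rn n => T k p.2 p.1 := fun k =>
    (hTm k).comp measurable_swap
  have step1 : hEnergy Ω m μ g ≤ ∫⁻ x, ∫⁻ y, C * ∑' k, (T k x y + T k y x) ∂μ ∂μ := by
    unfold hEnergy
    refine (lintegral_mono' Measure.restrict_le_self fun x =>
      lintegral_mono' Measure.restrict_le_self le_rfl).trans ?_
    refine lintegral_mono_ae ?_
    filter_upwards [hP] with x hx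
    refine lintegral_mono_ae ?_
    filter_upwards [hP] with y hy
    rcases eq_or_ne x y with rfl | hxy
    · simp
    obtain ⟨j, hj1, hj2⟩ := exists_mem_Ioc_zpow (dist_pos.2 hxy) one_lt_two
    obtain ⟨k, rfl⟩ : ∃ k : ℤ, j = -k := ⟨-j, by ring⟩
    have hj3 : dist x y ≤ 2 * 2 ^ (-k) := by
      rwa [zpow_add₀ two_ne_zero, zpow_one, mul_comm] at hj2
    refine (h x y hx hy k hj1 hj3).trans ?_
    gcongr
    refine le_trans (le_of_eq ?_) (ENNReal.le_tsum k)
    have hj4 : dist y x ≤ 2 * 2 ^ (-k) := by rwa [dist_comm]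
    simp only [hT, Set.indicator, Set.mem_ofPred_eq, hj3, hj4, if_true]
  have step2 : ∫⁻ x, ∫⁻ y, C * ∑' k, (T k x y + T k y x) ∂μ ∂μ =
      C * ∑' k, (∫⁻ x, ∫⁻ y, T k x y ∂μ ∂μ + ∫⁻ x, ∫⁻ y, T k y x ∂μ ∂μ) := by
    refine (lintegral_congr fun x => lintegral_const_mul_tsum_add C
      (fun k => (hTm k).comp (measurable_prodMk_left (x := x)))
      (fun k => (hTm' k).comp (measurable_prodMk_left (x := x)))).trans ?_
    exact lintegral_const_mul_tsum_add C (fun k => (hTm k).lintegral_prod_right')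
      (fun k => (hTm' k).lintegral_prod_right')
  refine step1.trans (step2.trans_le ?_)
  gcongr
  rw [← mul_assoc, ← ENNReal.tsum_mul_left]
  refine ENNReal.tsum_le_tsum fun k => ?_
  have hk := h3.lintegral_annulus_le (R k) (by positivity : (0 : ℝ) < 2 ^ (-k))
  simp_rw [← hT] at hk
  rw [lintegral_lintegral_swap (f := fun x y => T k y x) (hTm' k).aemeasurable, ← two_mul,
    mul_assoc]
  gcongr

/-! ### Measurable choice of corkscrew points -/

/-- The second alternative makes the search for an index total: where no member of the sequence is a
corkscrew point, the index found is `0`. -/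
lemma exists_refIndex (Ω : TopologicalSpace.Opens (Rn n)) (C₁ r : ℝ) (x : Rn n) :
    ∃ i, Cork Ω C₁ x r (TopologicalSpace.denseSeq (Rn n) i) ∨
      ∀ j, ¬ Cork Ω C₁ x r (TopologicalSpace.denseSeq (Rn n) j) := by
  by_cases h : ∃ i, Cork Ω C₁ x r (TopologicalSpace.denseSeq (Rn n) i)
  · exact h.imp fun i hi => Or.inl hi
  · exact ⟨0, Or.inr (not_exists.1 h)⟩

open Classical in
/-- The first corkscrew point for `B(x,r)` in a fixed dense sequence. -/
noncomputable def refPoint (Ω : TopologicalSpace.Opens (Rn n)) (C₁ r : ℝ) (x : Rn n) : Rn n :=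
  TopologicalSpace.denseSeq (Rn n) (Nat.find (exists_refIndex Ω C₁ r x))

lemma cork_refPoint {C₁ r : ℝ} {x : Rn n} (h : ∃ X, Cork Ω C₁ x r X) :
    Cork Ω C₁ x r (refPoint Ω C₁ r x) := by
  classical
  have hc := continuous_delta (Ω := Ω)
  have ho : IsOpen {X | Cork Ω C₁ x r X} := by
    refine Ω.isOpen.inter (IsOpen.inter (s := {X | dist X x < r})
      (t := {X | 3 / 4 * (C₁⁻¹ * r) < δ Ω X}) ?_ ?_)
    · exact isOpen_lt (by fun_prop) (by fun_prop)
    · exact isOpen_lt (by fun_prop) (by fun_prop)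
  obtain ⟨_, hX, i, rfl⟩ :=
    (TopologicalSpace.denseRange_denseSeq (Rn n)).inter_open_nonempty _ ho h
  refine (Nat.find_spec (exists_refIndex Ω C₁ r x)).resolve_right fun hn => hn i hX

/-- The function `f` is arbitrary: only countably many points are ever chosen, and each is a
corkscrew point for a measurable set of `x` (a ball or the empty set). -/
lemma measurable_comp_refPoint (f : Rn n → ℝ) (C₁ r : ℝ) :
    Measurable fun x => f (refPoint Ω C₁ r x) := by
  classical
  have hcork : ∀ X, MeasurableSet {x | Cork Ω C₁ x r X} := by
    intro X
    by_cases hX : X ∈ Ω ∧ 3 / 4 * (C₁⁻¹ * r) < δ Ω X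
    · have : {x | Cork Ω C₁ x r X} = {x | dist X x < r} := by
        ext x
        exact ⟨fun h => h.2.1, fun h => ⟨hX.1, h, hX.2⟩⟩
      rw [this]
      exact measurableSet_lt (by fun_prop) (by fun_prop)
    · have : {x | Cork Ω C₁ x r X} = ∅ := by
        ext x
        exact ⟨fun h => hX ⟨h.1, h.2.2⟩, fun h => h.elim⟩
      rw [this]
      exact MeasurableSet.empty
  have hfind : Measurable fun x => Nat.find (exists_refIndex Ω C₁ r x) := by
    refine measurable_find _ fun k => ?_
    refine (hcork _).union (s₂ := {x | ∀ j, ¬ Cork Ω C₁ x r (TopologicalSpace.denseSeq (Rn n) j)}) ?_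
    have : {x | ∀ j, ¬ Cork Ω C₁ x r (TopologicalSpace.denseSeq (Rn n) j)} =
        ⋂ j, {x | Cork Ω C₁ x r (TopologicalSpace.denseSeq (Rn n) j)}ᶜ := by
      ext x
      simp
    rw [this]
    exact MeasurableSet.iInter fun j => (hcork _).compl
  exact (measurable_of_countable fun i => f (TopologicalSpace.denseSeq (Rn n) i)).comp hfind

/-- The average of `u` near the reference corkscrew point for `B(x,2⁻ᵏ)`. -/
noncomputable def refAvg (Ω : TopologicalSpace.Opens (Rn n)) (m : Measure (Rn n)) (C₁ : ℝ)
    (u : Rn n → ℝ) (k : ℤ) (x : Rn n) : ℝ := avg Ω m u (refPoint Ω C₁ (2 ^ (-k)) x)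

lemma H1.cork_refPoint {C₁ : ℝ} (h1 : H1 Ω C₁) {x : Rn n} (hx : x ∈ bdry Ω) {k : ℤ}
    (ha : Adm Ω (2 ^ (-k))) : Cork Ω C₁ x (2 ^ (-k)) (refPoint Ω C₁ (2 ^ (-k)) x) :=
  MixedDim.cork_refPoint (h1.exists_cork hx (by positivity) ha)

lemma two_zpow_neg_mono {k l : ℤ} (h : k ≤ l) : (2 : ℝ) ^ (-l) ≤ 2 ^ (-k) :=
  zpow_le_zpow_right₀ one_le_two (by omega)

lemma exists_mem_of_bdry {x : Rn n} (hx : x ∈ bdry Ω) : ∃ X ∈ Ω, X ≠ x := by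
  obtain ⟨X, hX, -⟩ := Metric.mem_closure_iff.1 (bdry_subset_closure hx) 1 one_pos
  exact ⟨X, hX, fun h => notMem_bdry hX (h ▸ hx)⟩

lemma dist_le_diam_of_closure (hb : Bornology.IsBounded (Ω : Set (Rn n))) {x y : Rn n}
    (hx : x ∈ closure (Ω : Set (Rn n))) (hy : y ∈ closure (Ω : Set (Rn n))) :
    dist x y ≤ diam (Ω : Set (Rn n)) := by
  rw [← diam_closure]
  exact dist_le_diam_of_mem hb.closure hx hy

lemma exists_adm {x : Rn n} (hx : x ∈ bdry Ω) : ∃ k : ℤ, Adm Ω (2 ^ (-k)) := by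
  by_cases hb : Bornology.IsBounded (Ω : Set (Rn n))
  · obtain ⟨X, hX, hXx⟩ := exists_mem_of_bdry hx
    have hpos : 0 < diam (Ω : Set (Rn n)) := (dist_pos.2 hXx).trans_le
      (dist_le_diam_of_closure hb (subset_closure hX) (bdry_subset_closure hx))
    obtain ⟨a, ha, -⟩ := exists_mem_Ioc_zpow hpos one_lt_two
    exact ⟨-a, fun _ => by rwa [neg_neg]⟩
  · exact ⟨0, fun h => absurd h hb⟩

lemma tendsto_int_of_nat {f : ℤ → ℝ} {g : ℝ} (k : ℤ)
    (h : Tendsto (fun i : ℕ => f (k + i)) atTop (𝓝 g)) : Tendsto f atTop (𝓝 g) := by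
  have ht : Tendsto (fun j : ℤ => (j - k).toNat) atTop atTop := by
    refine tendsto_atTop.2 fun b => ?_
    filter_upwards [eventually_ge_atTop (k + b)] with j hj
    omega
  refine (h.comp ht).congr' ?_
  filter_upwards [eventually_ge_atTop k] with j hj
  simp only [Function.comp_apply]
  congr 1
  omega

lemma tendsto_nat_of_int {f : ℤ → ℝ} {g : ℝ} (k : ℤ) (h : Tendsto f atTop (𝓝 g)) :
    Tendsto (fun i : ℕ => f (k + i)) atTop (𝓝 g) :=
  h.comp (tendsto_atTop_add_const_left _ k tendsto_natCast_atTop_atTop)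

/-! ### The trace at a boundary point -/

/-- The decay rate of the weights. -/
noncomputable def decay (C₅ : ℝ) : ℝ := √((2 : ℝ) ^ (-C₅⁻¹))

lemma decay_nonneg (C₅ : ℝ) : 0 ≤ decay C₅ := Real.sqrt_nonneg _

lemma decay_lt_one {C₅ : ℝ} (h : 0 < C₅) : decay C₅ < 1 := by
  rw [decay, Real.sqrt_lt' one_pos, one_pow]
  exact Real.rpow_lt_one_of_one_lt_of_neg one_lt_two (by simpa using h)

lemma H3.shadowEnergy_ne_top {C₃ : ℝ≥0} (h3 : H3 Ω μ C₃) {K : ℝ} {u : Rn n → ℝ}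
    {F : Rn n → ℝ≥0∞} (hu : HasPoincare Ω m K u F) (M : ℝ) (k : ℤ) {x : Rn n} (hx : x ∈ bdry Ω) :
    shadowEnergy Ω m μ F M k x ≠ ⊤ :=
  ENNReal.mul_ne_top (ENNReal.inv_ne_top.2 (h3.measure_ball_pos hx (by positivity)).ne')
    (hu.setLIntegral_lt_top _).ne

/-- Puts the decay `2^(-εi)` in the split form `σ^i * σ^i` used by `ofReal_sq_sub_limit_le`. -/
lemma H5.scaleRatio_le_decay [IsLocallyFiniteMeasure μ] {C₃ C₄ : ℝ≥0} {C₅ : ℝ} (h3 : H3 Ω μ C₃)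
    (h4 : H4 Ω m C₄) (h5 : H5 Ω m μ C₅) {x : Rn n} (hx : x ∈ bdry Ω) (k : ℤ) (i : ℕ) :
    scaleRatio Ω m μ (k + i) x ≤
      max C₅ 1 * scaleRatio Ω m μ k x * (decay C₅ ^ i * decay C₅ ^ i) := by
  refine (h5.scaleRatio_le h3 h4 hx k i).trans_eq ?_
  rw [← mul_pow, decay, Real.mul_self_sqrt (by positivity)]
  ring

lemma H5.oscBound_le [IsLocallyFiniteMeasure μ] {C₃ C₄ : ℝ≥0} {C₅ : ℝ} (h3 : H3 Ω μ C₃)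
    (h4 : H4 Ω m C₄) (h5 : H5 Ω m μ C₅) (F : Rn n → ℝ≥0∞) {M : ℝ} (hM : 0 ≤ M) {x : Rn n}
    (hx : x ∈ bdry Ω) (k : ℤ) (i : ℕ) :
    oscBound Ω m F M x (2 ^ (-(k + i : ℤ))) ≤
      √(M ^ 2 * (max C₅ 1 * scaleRatio Ω m μ k x) * (decay C₅ ^ i * decay C₅ ^ i)) *
        √(shadowEnergy Ω m μ F M (k + i) x).toReal := by
  rw [oscBound_eq h3 h4 F hM hx, mul_assoc (M ^ 2)]
  gcongr
  exact h5.scaleRatio_le_decay h3 h4 hx k i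

lemma summable_decay {C₅ : ℝ} (h : 0 < C₅) (Q : ℝ) :
    Summable fun i : ℕ => Q * (decay C₅ ^ i * decay C₅ ^ i) := by
  refine Summable.mul_left _ ?_
  simp_rw [← mul_pow]
  have h0 := decay_nonneg C₅
  exact summable_geometric_of_lt_one (by positivity)
    (mul_lt_one_of_nonneg_of_lt_one_left h0 (decay_lt_one h) (decay_lt_one h).le)

/-- The weighted sum of the shadow energies at scales smaller than `2⁻ᵏ`. -/
noncomputable def tailEnergy (Ω : TopologicalSpace.Opens (Rn n)) (m μ : Measure (Rn n))
    (F : Rn n → ℝ≥0∞) (M σ : ℝ) (k : ℤ) (x : Rn n) : ℝ≥0∞ :=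
  ∑' i : ℕ, ENNReal.ofReal σ ^ i * shadowEnergy Ω m μ F M (k + i) x

lemma shadowEnergy_le_tailEnergy (F : Rn n → ℝ≥0∞) (M σ : ℝ) (k : ℤ) (x : Rn n) :
    shadowEnergy Ω m μ F M k x ≤ tailEnergy Ω m μ F M σ k x := by
  refine le_trans (le_of_eq ?_) (ENNReal.le_tsum 0)
  simp

/-- The averages of `u` near corkscrew points of `B(x,2⁻ᵏ)` have increments bounded by `oscBound`
with parameter `M`. -/
def OscControl (Ω : TopologicalSpace.Opens (Rn n)) (m : Measure (Rn n)) (C₁ : ℝ)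
    (u : Rn n → ℝ) (F : Rn n → ℝ≥0∞) (M : ℝ) : Prop :=
  ∀ x ∈ bdry Ω, ∀ k : ℤ, Adm Ω (2 ^ (-k)) →
    |refAvg Ω m C₁ u k x - refAvg Ω m C₁ u (k + 1) x| ≤ oscBound Ω m F M x (2 ^ (-k)) ∧
    ∀ y ∈ bdry Ω, dist x y ≤ 2 * 2 ^ (-k) →
      |refAvg Ω m C₁ u k x - refAvg Ω m C₁ u k y| ≤ oscBound Ω m F M x (2 ^ (-k))

lemma exists_oscControl {C₁ : ℝ} (h1 : H1 Ω C₁) {N : ℕ} (h2 : H2 Ω C₁ N) {C₄ : ℝ≥0}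
    (h4 : H4 Ω m C₄) (hΓ : (bdry Ω).Nonempty) (K : ℝ) (hK : 0 ≤ K) :
    ∃ M, 0 < M ∧ ∀ (u : Rn n → ℝ) (F : Rn n → ℝ≥0∞), HasPoincare Ω m K u F →
      ∀ M' ≥ M, OscControl Ω m C₁ u F M' := by
  obtain ⟨M, hM, h⟩ := exists_osc_cork h1.1 h2 h4 hΓ K hK
  refine ⟨M, hM, fun u F hu M' hM' x hx k ha => ?_⟩
  have hr : (0 : ℝ) < 2 ^ (-k) := by positivity
  obtain ⟨e1, e2⟩ := h u F hu x _ _ hx hr (h1.cork_refPoint hx ha)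
  have hmono := hu.oscBound_mono hM.le hM' x hr
  refine ⟨(e1 _ ?_).trans hmono, fun y hy hxy => (e2 y _ hxy (h1.cork_refPoint hy ha)).trans hmono⟩
  have hhalf : (2 : ℝ) ^ (-k) / 2 = 2 ^ (-(k + 1)) := by
    rw [neg_add, zpow_add₀ two_ne_zero, zpow_neg_one, div_eq_mul_inv]
  rw [hhalf]
  exact h1.cork_refPoint hx (ha.mono (two_zpow_neg_mono (by omega)))

lemma OscControl.increment_le [IsLocallyFiniteMeasure μ] {C₁ : ℝ} {C₃ C₄ : ℝ≥0} {C₅ : ℝ}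
    (h3 : H3 Ω μ C₃) (h4 : H4 Ω m C₄) (h5 : H5 Ω m μ C₅) {u : Rn n → ℝ} {F : Rn n → ℝ≥0∞} {M : ℝ}
    (hM : 0 ≤ M) (ho : OscControl Ω m C₁ u F M) {x : Rn n} (hx : x ∈ bdry Ω) {k : ℤ}
    (ha : Adm Ω (2 ^ (-k))) (i : ℕ) :
    |refAvg Ω m C₁ u (k + i) x - refAvg Ω m C₁ u (k + (i + 1 : ℕ)) x| ≤
      √(M ^ 2 * (max C₅ 1 * scaleRatio Ω m μ k x) * (decay C₅ ^ i * decay C₅ ^ i)) *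
        √(shadowEnergy Ω m μ F M (k + i) x).toReal := by
  have h := (ho x hx (k + i) (ha.mono (two_zpow_neg_mono (by omega)))).1
  rw [add_assoc] at h
  push_cast
  exact h.trans (h5.oscBound_le h3 h4 F hM hx k i)

lemma tsum_nat_ne_top {S : ℤ → ℝ≥0∞} (hS : ∑' k, S k ≠ ⊤) (k : ℤ) : ∑' i : ℕ, S (k + i) ≠ ⊤ := by
  refine ne_top_of_le_ne_top hS (ENNReal.tsum_comp_le_tsum_of_injective (fun i j h => ?_) S)
  simpa using h

lemma OscControl.exists_tendsto [IsLocallyFiniteMeasure μ] {C₁ : ℝ} {C₃ C₄ : ℝ≥0} {C₅ : ℝ}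
    (h3 : H3 Ω μ C₃) (h4 : H4 Ω m C₄) (h5 : H5 Ω m μ C₅) {u : Rn n → ℝ} {F : Rn n → ℝ≥0∞} {M : ℝ}
    (hM : 0 ≤ M) (ho : OscControl Ω m C₁ u F M) {x : Rn n} (hx : x ∈ bdry Ω)
    (hS : ∑' k, shadowEnergy Ω m μ F M k x ≠ ⊤) :
    ∃ g, Tendsto (fun k => refAvg Ω m C₁ u k x) atTop (𝓝 g) := by
  obtain ⟨k, ha⟩ := exists_adm hx
  have hρ := scaleRatio_nonneg (Ω := Ω) (m := m) (μ := μ) k x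
  have hσ := decay_nonneg C₅
  obtain ⟨g, hg⟩ := exists_tendsto_of_increments (a := fun i : ℕ => refAvg Ω m C₁ u (k + i) x)
    (fun i => by positivity) (summable_decay h5.1 (M ^ 2 * (max C₅ 1 * scaleRatio Ω m μ k x)))
    (tsum_nat_ne_top hS k) (ho.increment_le h3 h4 h5 hM hx ha)
  exact ⟨g, tendsto_int_of_nat k hg⟩

lemma OscControl.ofReal_sq_sub_le [IsLocallyFiniteMeasure μ] {C₁ : ℝ} {C₃ C₄ : ℝ≥0} {C₅ K : ℝ}
    (h3 : H3 Ω μ C₃) (h4 : H4 Ω m C₄) (h5 : H5 Ω m μ C₅) {u : Rn n → ℝ} {F : Rn n → ℝ≥0∞}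
    (hu : HasPoincare Ω m K u F) {M : ℝ} (hM : 0 ≤ M) (ho : OscControl Ω m C₁ u F M) {x : Rn n}
    (hx : x ∈ bdry Ω) {k : ℤ} (ha : Adm Ω (2 ^ (-k))) {g : ℝ}
    (hg : Tendsto (fun k => refAvg Ω m C₁ u k x) atTop (𝓝 g)) :
    ENNReal.ofReal (|refAvg Ω m C₁ u k x - g| ^ 2) ≤
      ENNReal.ofReal (M ^ 2 * max C₅ 1 / (1 - decay C₅) * scaleRatio Ω m μ k x) *
        tailEnergy Ω m μ F M (decay C₅) k x := by
  have hρ := scaleRatio_nonneg (Ω := Ω) (m := m) (μ := μ) k x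
  have h := ofReal_sq_sub_limit_le (a := fun i : ℕ => refAvg Ω m C₁ u (k + i) x)
    (Q := M ^ 2 * (max C₅ 1 * scaleRatio Ω m μ k x)) (by positivity) (decay_nonneg C₅)
    (decay_lt_one h5.1) (fun i => h3.shadowEnergy_ne_top hu M _ hx) (tendsto_nat_of_int k hg)
    (ho.increment_le h3 h4 h5 hM hx ha)
  simp only [Nat.cast_zero, add_zero] at h
  refine h.trans_eq ?_
  rw [tailEnergy]
  congr 2
  ring

lemma OscControl.ofReal_sq_sub_near_le [IsLocallyFiniteMeasure μ] {C₁ : ℝ} {C₃ C₄ : ℝ≥0} {C₅ K : ℝ}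
    (h3 : H3 Ω μ C₃) (h4 : H4 Ω m C₄) (h5 : H5 Ω m μ C₅) {u : Rn n → ℝ} {F : Rn n → ℝ≥0∞}
    (hu : HasPoincare Ω m K u F) {M : ℝ} (hM : 0 ≤ M) (ho : OscControl Ω m C₁ u F M) {x y : Rn n}
    (hx : x ∈ bdry Ω) (hy : y ∈ bdry Ω) {k : ℤ} (ha : Adm Ω (2 ^ (-k)))
    (hxy : dist x y ≤ 2 * 2 ^ (-k)) :
    ENNReal.ofReal (|refAvg Ω m C₁ u k x - refAvg Ω m C₁ u k y| ^ 2) ≤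
      ENNReal.ofReal (M ^ 2 * max C₅ 1 / (1 - decay C₅) * scaleRatio Ω m μ k x) *
        tailEnergy Ω m μ F M (decay C₅) k x := by
  have hρ := scaleRatio_nonneg (Ω := Ω) (m := m) (μ := μ) k x
  have h := (ho x hx k ha).2 y hy hxy
  rw [oscBound_eq h3 h4 F hM hx] at h
  have h1σ : 0 < 1 - decay C₅ := sub_pos.2 (decay_lt_one h5.1)
  -- The bound is deliberately weakened to the same expression as in `OscControl.ofReal_sq_sub_le`,
  -- so that all three differences can be treated alike.
  have hfac : M ^ 2 ≤ M ^ 2 * max C₅ 1 / (1 - decay C₅) := by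
    rw [le_div_iff₀ h1σ]
    have : (1 : ℝ) ≤ max C₅ 1 := le_max_right _ _
    have := decay_nonneg C₅
    gcongr
    linarith
  calc ENNReal.ofReal (|refAvg Ω m C₁ u k x - refAvg Ω m C₁ u k y| ^ 2)
      ≤ ENNReal.ofReal ((√(M ^ 2 * scaleRatio Ω m μ k x) *
          √(shadowEnergy Ω m μ F M k x).toReal) ^ 2) := by gcongr
    _ = ENNReal.ofReal (M ^ 2 * scaleRatio Ω m μ k x) * shadowEnergy Ω m μ F M k x := by
        rw [mul_pow, Real.sq_sqrt (by positivity), Real.sq_sqrt ENNReal.toReal_nonneg,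
          ENNReal.ofReal_mul (by positivity), ENNReal.ofReal_toReal
            (h3.shadowEnergy_ne_top hu M k hx)]
    _ ≤ _ := by
        gcongr
        exact shadowEnergy_le_tailEnergy F M _ k x

/-! ### The energy of the trace -/

lemma ofReal_inv_muBall [IsLocallyFiniteMeasure μ] {C₃ : ℝ≥0} (h3 : H3 Ω μ C₃) {z : Rn n}
    (hz : z ∈ bdry Ω) {r : ℝ} (hr : 0 < r) :
    ENNReal.ofReal (μ.real (ball z r))⁻¹ = (μ (ball z r))⁻¹ := by
  rw [ENNReal.ofReal_inv_of_pos (h3.muBall_pos hz hr), Measure.real,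
    ENNReal.ofReal_toReal measure_ball_lt_top.ne]

lemma ofReal_hKer_mul_le [IsLocallyFiniteMeasure μ] {C₃ C₄ : ℝ≥0} (h3 : H3 Ω μ C₃)
    (h4 : H4 Ω m C₄) {x y z : Rn n} (hx : x ∈ bdry Ω) (hz : z ∈ bdry Ω) {k : ℤ}
    (h1 : 2 ^ (-k) < dist x y) (h2 : dist x y ≤ 2 * 2 ^ (-k)) (hxz : dist x z ≤ dist x y)
    {B : ℝ} (hB : 0 ≤ B) :
    ENNReal.ofReal (hKer Ω m μ x y) * ENNReal.ofReal (B * scaleRatio Ω m μ k z) ≤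
      ENNReal.ofReal (B * ((C₄ : ℝ) ^ 2 * (C₃ : ℝ) ^ 2)) * (μ (ball z (2 ^ (-k))))⁻¹ := by
  rw [← ofReal_inv_muBall h3 hz (by positivity), ← ENNReal.ofReal_mul (hKer_nonneg x y),
    ← ENNReal.ofReal_mul (by positivity)]
  refine ENNReal.ofReal_le_ofReal ?_
  calc hKer Ω m μ x y * (B * scaleRatio Ω m μ k z)
      = B * (hKer Ω m μ x y * scaleRatio Ω m μ k z) := by ring
    _ ≤ B * ((C₄ : ℝ) ^ 2 * (C₃ : ℝ) ^ 2 * (μ.real (ball z (2 ^ (-k))))⁻¹) := by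
        exact mul_le_mul_of_nonneg_left (hKer_mul_scaleRatio_le h3 h4 hx hz h1 h2 hxz) hB
    _ = _ := by ring

lemma ofReal_sq_sub_le_three (a b c d : ℝ) :
    ENNReal.ofReal (|a - d| ^ 2) ≤ 3 * (ENNReal.ofReal (|b - a| ^ 2) +
      ENNReal.ofReal (|b - c| ^ 2) + ENNReal.ofReal (|c - d| ^ 2)) := by
  rw [← ENNReal.ofReal_add (by positivity) (by positivity),
    ← ENNReal.ofReal_add (by positivity) (by positivity),
    show (3 : ℝ≥0∞) = ENNReal.ofReal 3 by simp, ← ENNReal.ofReal_mul (by norm_num)]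
  refine ENNReal.ofReal_le_ofReal ?_
  simp only [sq_abs]
  nlinarith [sq_nonneg ((b - a) + (b - c)), sq_nonneg ((b - a) + (c - d)),
    sq_nonneg ((b - c) - (c - d))]

/-- Two boundary points at distance more than `r` force `diam Ω > r`, so corkscrew points exist at
every scale that the energy sees, even for bounded `Ω`. -/
lemma adm_of_lt_dist {x y : Rn n} (hx : x ∈ bdry Ω) (hy : y ∈ bdry Ω) {r : ℝ}
    (h : r < dist x y) : Adm Ω r := fun hb =>
  h.trans_le (dist_le_diam_of_closure hb (bdry_subset_closure hx) (bdry_subset_closure hy))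

/-- Go from `g x` to `g y` through the reference averages of `x` and `y` at scale `2⁻ᵏ`. Two of the
three differences are charged to `x` and one to `y`; the factor `6` covers both. -/
lemma OscControl.hKer_mul_le [IsLocallyFiniteMeasure μ] {C₁ : ℝ} {C₃ C₄ : ℝ≥0} {C₅ K : ℝ}
    (h3 : H3 Ω μ C₃) (h4 : H4 Ω m C₄) (h5 : H5 Ω m μ C₅) {u : Rn n → ℝ} {F : Rn n → ℝ≥0∞}
    (hu : HasPoincare Ω m K u F) {M : ℝ} (hM : 0 ≤ M) (ho : OscControl Ω m C₁ u F M)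
    {x y : Rn n} (hx : x ∈ bdry Ω) (hy : y ∈ bdry Ω) {g : Rn n → ℝ}
    (hgx : Tendsto (fun k => refAvg Ω m C₁ u k x) atTop (𝓝 (g x)))
    (hgy : Tendsto (fun k => refAvg Ω m C₁ u k y) atTop (𝓝 (g y))) {k : ℤ}
    (hk1 : 2 ^ (-k) < dist x y) (hk2 : dist x y ≤ 2 * 2 ^ (-k)) :
    ENNReal.ofReal (hKer Ω m μ x y * |g x - g y| ^ 2) ≤
      6 * ENNReal.ofReal (M ^ 2 * max C₅ 1 / (1 - decay C₅) * ((C₄ : ℝ) ^ 2 * (C₃ : ℝ) ^ 2)) *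
        ((μ (ball x (2 ^ (-k))))⁻¹ * tailEnergy Ω m μ F M (decay C₅) k x +
          (μ (ball y (2 ^ (-k))))⁻¹ * tailEnergy Ω m μ F M (decay C₅) k y) := by
  have ha : Adm Ω (2 ^ (-k)) := adm_of_lt_dist hx hy hk1
  have h1σ : 0 < 1 - decay C₅ := sub_pos.2 (decay_lt_one h5.1)
  have hB : 0 ≤ M ^ 2 * max C₅ 1 / (1 - decay C₅) := by positivity
  have e1 := ho.ofReal_sq_sub_le h3 h4 h5 hu hM hx ha hgx
  have e2 := ho.ofReal_sq_sub_near_le h3 h4 h5 hu hM hx hy ha hk2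
  have e3 := ho.ofReal_sq_sub_le h3 h4 h5 hu hM hy ha hgy
  have k1 := ofReal_hKer_mul_le h3 h4 hx hx hk1 hk2 (by simp) hB
  have k2 := ofReal_hKer_mul_le h3 h4 hx hy hk1 hk2 le_rfl hB
  set B := M ^ 2 * max C₅ 1 / (1 - decay C₅)
  set D := ENNReal.ofReal (B * ((C₄ : ℝ) ^ 2 * (C₃ : ℝ) ^ 2))
  set Rx := tailEnergy Ω m μ F M (decay C₅) k x
  set Ry := tailEnergy Ω m μ F M (decay C₅) k y
  rw [ENNReal.ofReal_mul (hKer_nonneg x y)]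
  set κ := ENNReal.ofReal (hKer Ω m μ x y)
  set qx := ENNReal.ofReal (B * scaleRatio Ω m μ k x)
  set qy := ENNReal.ofReal (B * scaleRatio Ω m μ k y)
  set ix := (μ (ball x (2 ^ (-k))))⁻¹
  set iy := (μ (ball y (2 ^ (-k))))⁻¹
  calc κ * ENNReal.ofReal (|g x - g y| ^ 2)
      ≤ κ * (3 * (qx * Rx + qx * Rx + qy * Ry)) := by
        gcongr
        exact (ofReal_sq_sub_le_three (g x) (refAvg Ω m C₁ u k x) (refAvg Ω m C₁ u k y)
          (g y)).trans (by gcongr)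
    _ = 6 * ((κ * qx) * Rx) + 3 * ((κ * qy) * Ry) := by ring
    _ ≤ 6 * ((D * ix) * Rx) + 6 * ((D * iy) * Ry) := by
        gcongr
        norm_num
    _ = _ := by ring

/-! ### Nontangential limits -/

lemma H5.tendsto_oscBound [IsLocallyFiniteMeasure μ] {C₃ C₄ : ℝ≥0} {C₅ : ℝ}
    (h3 : H3 Ω μ C₃) (h4 : H4 Ω m C₄) (h5 : H5 Ω m μ C₅) {F : Rn n → ℝ≥0∞} {M : ℝ}
    (hM : 0 ≤ M) {x : Rn n} (hx : x ∈ bdry Ω)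
    (hS : ∑' k, shadowEnergy Ω m μ F M k x ≠ ⊤) :
    Tendsto (fun k : ℤ => oscBound Ω m F M x (2 ^ (-k))) atTop (𝓝 0) := by
  refine tendsto_int_of_nat 0 ?_
  have t1 := (summable_decay h5.1
    (M ^ 2 * (max C₅ 1 * scaleRatio Ω m μ 0 x))).tendsto_atTop_zero
  have t2 := (ENNReal.summable_toReal (tsum_nat_ne_top hS 0)).tendsto_atTop_zero
  have t3 := (t1.sqrt).mul (t2.sqrt)
  rw [Real.sqrt_zero, mul_zero] at t3
  exact squeeze_zero (fun i => oscBound_nonneg F hM x (by positivity))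
    (fun i => h5.oscBound_le h3 h4 F hM hx 0 i) t3

/-- Points of a nontangential cone control the averages of `u`. -/
def ConeControl (Ω : TopologicalSpace.Opens (Rn n)) (m : Measure (Rn n)) (C₁ : ℝ)
    (u : Rn n → ℝ) (F : Rn n → ℝ≥0∞) (A M : ℝ) (J : ℕ) : Prop :=
  ∀ x ∈ bdry Ω, ∀ X ∈ Ω, dist X x ≤ A * δ Ω X → ∀ k : ℤ, 2 ^ (-(k + J)) < δ Ω X →
    δ Ω X ≤ 2 * 2 ^ (-(k + J)) → Adm Ω (2 ^ (-k)) →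
    |avg Ω m u X - refAvg Ω m C₁ u k x| ≤ oscBound Ω m F M x (2 ^ (-k)) ∧
    ⨍ Z in ball X (δ Ω X / 2), |u Z - avg Ω m u X| ∂m ≤ oscBound Ω m F M x (2 ^ (-k))

lemma exists_coneControl {C₁ : ℝ} (h1 : H1 Ω C₁) {N : ℕ} (h2 : H2 Ω C₁ N) {C₄ : ℝ≥0}
    (h4 : H4 Ω m C₄) (hΓ : (bdry Ω).Nonempty) (K A : ℝ) (hK : 0 ≤ K) (hA : 0 < A) :
    ∃ (M : ℝ) (J : ℕ), 0 < M ∧ ∀ (u : Rn n → ℝ) (F : Rn n → ℝ≥0∞), HasPoincare Ω m K u F →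
      ∀ M' ≥ M, ConeControl Ω m C₁ u F A M' J := by
  obtain ⟨M, J, hM, h⟩ := exists_osc_nontangential h1 h2 h4 hΓ K A hK hA
  refine ⟨M, J, hM, fun u F hu M' hM' x hx X hX hXx k hk1 hk2 ha => ?_⟩
  have hmono := hu.oscBound_mono hM.le hM' x (by positivity : (0 : ℝ) < 2 ^ (-k))
  have hJ : (2 : ℝ) ^ J * 2 ^ (-(k + J)) = 2 ^ (-k) := by
    rw [← zpow_natCast, ← zpow_add₀ two_ne_zero]
    congr 1
    ring
  obtain ⟨e1, e2⟩ := h u F hu x X (refPoint Ω C₁ (2 ^ (-k)) x) (2 ^ (-(k + J))) hx (by positivity)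
    hX hXx hk1 hk2 (by rwa [hJ]) (by rw [hJ]; exact h1.cork_refPoint hx ha)
  rw [hJ] at e1 e2
  exact ⟨e1.trans hmono, e2.trans hmono⟩

lemma ConeControl.exists_delta [IsLocallyFiniteMeasure μ] {C₁ : ℝ} {C₃ C₄ : ℝ≥0} {C₅ : ℝ}
    (h3 : H3 Ω μ C₃) (h4 : H4 Ω m C₄) (h5 : H5 Ω m μ C₅) {u : Rn n → ℝ} {F : Rn n → ℝ≥0∞}
    {A M : ℝ} {J : ℕ} (hM : 0 ≤ M) (hc : ConeControl Ω m C₁ u F A M J) {x : Rn n}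
    (hx : x ∈ bdry Ω) (hS : ∑' k, shadowEnergy Ω m μ F M k x ≠ ⊤) {g : ℝ}
    (hg : Tendsto (fun k => refAvg Ω m C₁ u k x) atTop (𝓝 g)) {ε : ℝ} (hε : 0 < ε) :
    ∃ η > 0, ∀ X ∈ Ω, dist X x ≤ A * δ Ω X → δ Ω X < η →
      |avg Ω m u X - g| < ε ∧ ⨍ Z in ball X (δ Ω X / 2), |u Z - avg Ω m u X| ∂m < ε := by
  obtain ⟨k₀, hk₀⟩ := exists_adm hx
  have ev1 := (H5.tendsto_oscBound h3 h4 h5 hM hx hS).eventually_lt_const (half_pos hε)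
  have ev2 := Metric.tendsto_nhds.1 hg (ε / 2) (half_pos hε)
  obtain ⟨k₁, hk₁⟩ := eventually_atTop.1 ((ev1.and ev2).and (eventually_ge_atTop k₀))
  refine ⟨2 ^ (-(k₁ + J)), by positivity, fun X hX hXx hXη => ?_⟩
  have hδ := delta_pos ⟨x, hx⟩ hX
  -- The scale `k` is read off from `δ(X)` with an offset of `J` generations, since the chain from
  -- `X` ends at a corkscrew point `2 ^ J` times coarser.
  obtain ⟨a, ha1, ha2⟩ := exists_mem_Ioc_zpow hδ one_lt_two
  obtain ⟨k, rfl⟩ : ∃ k : ℤ, a = -(k + J) := ⟨-a - J, by ring⟩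
  rw [zpow_add₀ two_ne_zero, zpow_one, mul_comm] at ha2
  have hk : k₁ ≤ k := by
    have := (zpow_lt_zpow_iff_right₀ (one_lt_two : (1 : ℝ) < 2)).1 (ha1.trans hXη)
    omega
  obtain ⟨⟨e1, e2⟩, e3⟩ := hk₁ k hk
  obtain ⟨f1, f2⟩ := hc x hx X hX hXx k ha1 ha2 (hk₀.mono (two_zpow_neg_mono e3))
  rw [Real.dist_eq] at e2
  refine ⟨?_, f2.trans_lt (e1.trans (half_lt_self hε))⟩
  have := abs_sub_le (avg Ω m u X) (refAvg Ω m C₁ u k x) g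
  linarith

lemma H4.average_abs_sub_le {C₄ : ℝ≥0} (h4 : H4 Ω m C₄) {u : Rn n → ℝ}
    (hu : LocallyIntegrableOn u Ω m) {X : Rn n} {s : ℝ} (hs : 0 < s)
    (hXs : ball X (2 * s) ⊆ Ω) (a g : ℝ) :
    ⨍ Z in ball X s, |u Z - g| ∂m ≤ ⨍ Z in ball X s, |u Z - a| ∂m + |a - g| := by
  have hsub := ball_sub_double X hs hXs
  have hX : X ∈ closure (Ω : Set (Rn n)) := subset_closure (hsub (mem_ball_self hs))
  have hpos : 0 < m.real (ball X s) := by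
    rw [← mBall_eq_of_subset hsub]
    exact h4.mBall_pos hX hs
  have hfin : m (ball X s) < ⊤ := by
    have := h4.measure_ball_lt_top hX s
    rwa [Set.inter_eq_left.2 hsub] at this
  have hi : IntegrableOn u (ball X s) m := integrableOn_ball hu hs hXs
  have hic : ∀ c : ℝ, IntegrableOn (fun _ : Rn n => c) (ball X s) m :=
    fun c => integrableOn_const hfin.ne
  have hint : ∀ c : ℝ, IntegrableOn (fun Z => |u Z - c|) (ball X s) m :=
    fun c => (Integrable.sub hi (hic c)).abs
  have h : ∫ Z in ball X s, |u Z - g| ∂m ≤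
      ∫ Z in ball X s, |u Z - a| ∂m + m.real (ball X s) * |a - g| := by
    have : ∫ Z in ball X s, (|u Z - a| + |a - g|) ∂m =
        ∫ Z in ball X s, |u Z - a| ∂m + m.real (ball X s) * |a - g| := by
      rw [integral_add (hint a) (hic _), setIntegral_const, smul_eq_mul]
    rw [← this]
    exact integral_mono (hint g) (Integrable.add (hint a) (hic _)) fun Z => abs_sub_le _ _ _
  rw [average_eq, average_eq, smul_eq_mul, smul_eq_mul, measureReal_restrict_apply_univ]
  calc _ ≤ (m.real (ball X s))⁻¹ *
        (∫ Z in ball X s, |u Z - a| ∂m + m.real (ball X s) * |a - g|) := by gcongr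
    _ = _ := by rw [mul_add, inv_mul_cancel_left₀ hpos.ne']

/-! ### Access cones -/

lemma dist_dyadicCube_le {t : ℝ} {j : ℤ} {κ : Fin n → ℤ} {p q : Rn n} (hp : p ∈ dyadicCube t j κ)
    (hq : q ∈ dyadicCube t j κ) : dist p q ≤ √(∑ _i : Fin n, (t * 2 ^ (-j)) ^ 2) := by
  rw [EuclideanSpace.dist_eq]
  gcongr with i
  rw [Real.dist_eq]
  have := abs_sub_le (p i) (((κ i : ℝ) + 1 / 2) * (2 : ℝ) ^ (-j)) (q i)
  have h1 := hp i
  have h2 := hq i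
  rw [abs_sub_comm] at h2
  linarith

lemma isBounded_dyadicCube (t : ℝ) (j : ℤ) (κ : Fin n → ℤ) :
    Bornology.IsBounded (dyadicCube t j κ) :=
  Metric.isBounded_iff.2 ⟨_, fun _ hp _ hq => dist_dyadicCube_le hp hq⟩

lemma le_diam_dyadicCube (hn : 0 < n) (j : ℤ) (κ : Fin n → ℤ) :
    (2 : ℝ) ^ (-j) ≤ diam (dyadicCube 1 j κ) := by
  have hr : (0 : ℝ) < 2 ^ (-j) := by positivity
  -- `p 0` and `p 1` are opposite corners; one coordinate, available because `n > 0`, already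
  -- separates them by the side length.
  set p : ℝ → Rn n := fun s => WithLp.toLp 2 fun i => ((κ i : ℝ) + s) * (2 : ℝ) ^ (-j) with hp
  have hmem : ∀ s : ℝ, |s - 1 / 2| ≤ 1 / 2 → p s ∈ dyadicCube 1 j κ := by
    intro s hs i
    have : p s i - ((κ i : ℝ) + 1 / 2) * (2 : ℝ) ^ (-j) = (s - 1 / 2) * 2 ^ (-j) := by
      simp only [hp]
      ring
    rw [this, abs_mul, abs_of_pos hr]
    gcongr
  refine le_trans ?_ (dist_le_diam_of_mem (isBounded_dyadicCube 1 j κ)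
    (hmem 1 (by norm_num)) (hmem 0 (by norm_num)))
  have h := PiLp.norm_apply_le (p 1 - p 0) (⟨0, hn⟩ : Fin n)
  rw [← dist_eq_norm] at h
  refine le_trans (le_of_eq ?_) h
  have : (p 1 - p 0) (⟨0, hn⟩ : Fin n) = 2 ^ (-j) := by
    simp only [hp, PiLp.sub_apply]
    ring
  rw [this, Real.norm_eq_abs, abs_of_pos hr]

lemma setDist_le {A B : Set (Rn n)} {a b : Rn n} (ha : a ∈ A) (hb : b ∈ B) :
    setDist A B ≤ dist a b :=
  csInf_le ⟨0, by rintro _ ⟨_, _, _, _, rfl⟩; exact dist_nonneg⟩ ⟨a, ha, b, hb, rfl⟩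

lemma exists_dist_lt_of_setDist_lt {A B : Set (Rn n)} (hA : A.Nonempty) (hB : B.Nonempty) {r : ℝ}
    (h : setDist A B < r) : ∃ a ∈ A, ∃ b ∈ B, dist a b < r := by
  obtain ⟨_, ⟨a, ha, b, hb, rfl⟩, hab⟩ := exists_lt_of_csInf_lt (hA.image2 hB) h
  exact ⟨a, ha, b, hb, hab⟩

/-- The access cones are nontangential. -/
lemma cone_nontangential (hn : 0 < n) (𝔻 : DyadicSystem (bdry Ω)) {Ca : ℝ} (hCa : 0 < Ca)
    {x X : Rn n} (hΓ : (bdry Ω).Nonempty) (hX : X ∈ cone Ω 𝔻 Ca x) :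
    X ∈ Ω ∧ dist X x ≤ (1 + Ca) * δ Ω X := by
  obtain ⟨k, Q, hQ, hxQ, j, κ, ⟨hI, hfar, -⟩, hl, hd, hXI⟩ := hX
  refine ⟨hI hXI, ?_⟩
  have hr : (0 : ℝ) < 2 ^ (-j) := by positivity
  have hdiam := le_diam_dyadicCube hn j κ
  have hXI4 : X ∈ dyadicCube 4 j κ := fun i => (hXI i).trans (by linarith)
  have hδ : 4 * diam (dyadicCube 1 j κ) ≤ δ Ω X :=
    hfar.trans ((le_infDist hΓ).2 fun y hy => setDist_le hXI4 hy)
  have hk : (0 : ℝ) < 2 ^ (-k) := by positivity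
  -- The infimum need not be attained, so `2 ℓ(Q)` is relaxed to `3 ℓ(Q)`. With the diameter of `Q`
  -- this gives `|X-x| ≤ diam I + 4 ℓ(Q)`, where `diam I ≤ δ(X)/4` and `ℓ(Q) ≤ Ca ℓ(I) ≤ Ca δ(X)/4`.
  obtain ⟨p, hp, q, hq, hpq⟩ := exists_dist_lt_of_setDist_lt ⟨X, hXI⟩ ⟨x, hxQ⟩
    (hd.trans_lt (by linarith : 2 * (2 : ℝ) ^ (-k) < 3 * 2 ^ (-k)))
  have h1 := dist_le_diam_of_mem (isBounded_dyadicCube 1 j κ) hXI hp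
  have h2 := 𝔻.diam_le k Q hQ q hq x hxQ
  have h3 := dist_triangle4 X p q x
  have h4 : (2 : ℝ) ^ (-k) ≤ Ca * 2 ^ (-j) := by rwa [inv_mul_le_iff₀ hCa] at hl
  have h5 : Ca * 2 ^ (-j) ≤ Ca * (δ Ω X / 4) := by
    gcongr
    linarith
  linarith

/-! ### The trace -/

/-- The properties that characterize the trace `g` of `u` at the boundary point `x`. -/
def IsTraceAt (Ω : TopologicalSpace.Opens (Rn n)) (m : Measure (Rn n)) (C₁ : ℝ)
    (𝔻 : DyadicSystem (bdry Ω)) (Ca : ℝ) (u : Rn n → ℝ) (g : ℝ) (x : Rn n) : Prop :=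
  Tendsto (fun k => refAvg Ω m C₁ u k x) atTop (𝓝 g) ∧
  Tendsto (fun X => ⨍ Z in ball X (δ Ω X / 2), u Z ∂m) (coneFilter Ω 𝔻 Ca x) (𝓝 g) ∧
  Tendsto (fun X => ⨍ Z in ball X (δ Ω X / 2), |u Z - g| ∂m) (coneFilter Ω 𝔻 Ca x) (𝓝 0)

lemma pos_of_bdry {x : Rn n} (hx : x ∈ bdry Ω) : 0 < n := by
  rcases Nat.eq_zero_or_pos n with rfl | h
  · obtain ⟨X, -, hX⟩ := exists_mem_of_bdry hx
    exact absurd (Subsingleton.elim X x) hX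
  · exact h

lemma ConeControl.isTraceAt [IsLocallyFiniteMeasure μ] {C₁ : ℝ} {C₃ C₄ : ℝ≥0} {C₅ K : ℝ}
    (h3 : H3 Ω μ C₃) (h4 : H4 Ω m C₄) (h5 : H5 Ω m μ C₅) {u : Rn n → ℝ} {F : Rn n → ℝ≥0∞}
    (hu : HasPoincare Ω m K u F) (𝔻 : DyadicSystem (bdry Ω)) {Ca : ℝ} (hCa : 0 < Ca)
    {M : ℝ} {J : ℕ} (hM : 0 ≤ M) (hc : ConeControl Ω m C₁ u F (1 + Ca) M J) {x : Rn n}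
    (hx : x ∈ bdry Ω) (hS : ∑' k, shadowEnergy Ω m μ F M k x ≠ ⊤) {g : ℝ}
    (hg : Tendsto (fun k => refAvg Ω m C₁ u k x) atTop (𝓝 g)) :
    IsTraceAt Ω m C₁ 𝔻 Ca u g x := by
  have hn := pos_of_bdry hx
  have key : ∀ ε > 0, ∀ᶠ X in coneFilter Ω 𝔻 Ca x, X ∈ Ω ∧ |avg Ω m u X - g| < ε ∧
      ⨍ Z in ball X (δ Ω X / 2), |u Z - avg Ω m u X| ∂m < ε := by
    intro ε hε
    obtain ⟨η, hη, h⟩ := hc.exists_delta h3 h4 h5 hM hx hS hg hε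
    have h1 : ∀ᶠ X in coneFilter Ω 𝔻 Ca x, δ Ω X < η :=
      (tendsto_comap.eventually_lt_const hη).filter_mono inf_le_left
    have h2 : ∀ᶠ X in coneFilter Ω 𝔻 Ca x, X ∈ cone Ω 𝔻 Ca x :=
      (eventually_principal.2 fun _ h => h).filter_mono inf_le_right
    filter_upwards [h1, h2] with X hX1 hX2
    obtain ⟨h3, h4⟩ := cone_nontangential hn 𝔻 hCa ⟨x, hx⟩ hX2
    exact ⟨h3, h X h3 h4 hX1⟩
  refine ⟨hg, Metric.tendsto_nhds.2 fun ε hε => ?_, Metric.tendsto_nhds.2 fun ε hε => ?_⟩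
  · filter_upwards [key ε hε] with X hX
    exact hX.2.1
  · filter_upwards [key (ε / 2) (half_pos hε)] with X hX
    have hδ := delta_pos ⟨x, hx⟩ hX.1
    have h := h4.average_abs_sub_le hu.locallyIntegrableOn (half_pos hδ)
      (ball_half_delta_subset hX.1) (avg Ω m u X) g
    have h0 : 0 ≤ ⨍ Z in ball X (δ Ω X / 2), |u Z - g| ∂m := by
      rw [average_eq, smul_eq_mul]
      have : 0 ≤ ∫ Z in ball X (δ Ω X / 2), |u Z - g| ∂m :=
        integral_nonneg fun Z => abs_nonneg _
      positivity
    rw [Real.dist_eq, sub_zero, abs_of_nonneg h0]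
    linarith [hX.2.1, hX.2.2]

/-- Existence of the trace, with the energy bound. -/
lemma exists_trace [IsLocallyFiniteMeasure μ] {C₁ : ℝ} (h1 : H1 Ω C₁) {N : ℕ} (h2 : H2 Ω C₁ N)
    {C₃ C₄ : ℝ≥0} {C₅ : ℝ} (h3 : H3 Ω μ C₃) (h4 : H4 Ω m C₄) (h5 : H5 Ω m μ C₅)
    (𝔻 : DyadicSystem (bdry Ω)) {Ca : ℝ} (hCa : 1000 * C₁ * √n ≤ Ca) (K : ℝ) (hK : 0 ≤ K) :
    ∃ C : ℝ≥0, ∀ (u : Rn n → ℝ) (F : Rn n → ℝ≥0∞), HasPoincare Ω m K u F →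
      ∃ g : Rn n →ₘ[μ] ℝ, hEnergy Ω m μ g ≤ C * ∫⁻ Z, F Z ∂m.restrict Ω ∧
        ∀ᵐ x ∂μ, IsTraceAt Ω m C₁ 𝔻 Ca u (g x) x := by
  rcases (bdry Ω).eq_empty_or_nonempty with hΓ | hΓ
  · refine ⟨0, fun u F _ => ⟨0, ?_, ?_⟩⟩
    · simp [hEnergy, hΓ]
    · filter_upwards [h3.ae_mem_bdry] with x hx
      rw [hΓ] at hx
      exact hx.elim
  obtain ⟨x₀, hx₀⟩ := hΓ
  have hn := pos_of_bdry hx₀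
  have hCa0 : 0 < Ca := by
    have := h1.1
    have : (0 : ℝ) < √n := Real.sqrt_pos.2 (by exact_mod_cast hn)
    exact lt_of_lt_of_le (by positivity) hCa
  have := h4.isLocallyFiniteMeasure
  obtain ⟨M₁, hM₁, hosc⟩ := exists_oscControl h1 h2 h4 ⟨x₀, hx₀⟩ K hK
  obtain ⟨M₂, J, -, hcone⟩ := exists_coneControl h1 h2 h4 ⟨x₀, hx₀⟩ K (1 + Ca) hK (by positivity)
  -- A common parameter, so that one exceptional null set, where `∑ₖ Sₖ` diverges, serves both for
  -- the existence of the limit and for its cone version.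
  set M := max M₁ M₂
  have hM : 0 < M := hM₁.trans_le (le_max_left _ _)
  obtain ⟨C, hC⟩ := h3.exists_tsum_shadowEnergy_le (m := m) (Ω := Ω) hM
  set σ := decay C₅
  set B : ℝ≥0∞ := 6 * ENNReal.ofReal (M ^ 2 * max C₅ 1 / (1 - σ) *
    ((C₄ : ℝ) ^ 2 * (C₃ : ℝ) ^ 2))
  set D : ℝ≥0∞ := B * (2 * ((C₃ : ℝ≥0∞) ^ 2 * ((1 - ENNReal.ofReal σ)⁻¹ * C)))
  have hσ : (1 - ENNReal.ofReal σ)⁻¹ ≠ ⊤ := by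
    refine ENNReal.inv_ne_top.2 (tsub_pos_of_lt ?_).ne'
    rw [← ENNReal.ofReal_one]
    exact (ENNReal.ofReal_lt_ofReal_iff one_pos).2 (decay_lt_one h5.1)
  have hD : D ≠ ⊤ := by finiteness
  refine ⟨D.toNNReal, fun u F hu => ?_⟩
  rw [ENNReal.coe_toNNReal hD]
  have ho := hosc u F hu M (le_max_left _ _)
  have hc := hcone u F hu M (le_max_right _ _)
  have hSm : ∀ k, Measurable (shadowEnergy Ω m μ F M k) := measurable_shadowEnergy hu.measurable M
  have hsum := hC F hu.measurable
  have hae : ∀ᵐ x ∂μ, ∑' k, shadowEnergy Ω m μ F M k x ≠ ⊤ := by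
    have hlt : ∫⁻ x, ∑' k, shadowEnergy Ω m μ F M k x ∂μ ≠ ⊤ := by
      rw [lintegral_tsum fun k => (hSm k).aemeasurable]
      exact (hsum.trans_lt (ENNReal.mul_lt_top ENNReal.coe_lt_top hu.lintegral_lt_top)).ne
    filter_upwards [ae_lt_top (Measurable.tsum hSm) hlt] with x hx
    exact hx.ne
  -- Defined everywhere, with a junk value where the limit fails to exist. Measurability comes from
  -- a.e. convergence of the measurable reference averages.
  set f : Rn n → ℝ := fun x => limUnder atTop fun k => refAvg Ω m C₁ u k x
  have hf : ∀ᵐ x ∂μ, IsTraceAt Ω m C₁ 𝔻 Ca u (f x) x := by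
    filter_upwards [hae, h3.ae_mem_bdry] with x hS hx
    exact hc.isTraceAt h3 h4 h5 hu 𝔻 hCa0 hM.le hx hS
      (tendsto_nhds_limUnder (ho.exists_tendsto h3 h4 h5 hM.le hx hS))
  have hfm : AEMeasurable f μ :=
    aemeasurable_of_tendsto_metrizable_ae atTop
      (fun k : ℤ => (measurable_comp_refPoint (avg Ω m u) C₁ (2 ^ (-k))).aemeasurable)
      (hf.mono fun x hx => hx.1)
  have hfg := AEEqFun.coeFn_mk f hfm.aestronglyMeasurable
  refine ⟨AEEqFun.mk f hfm.aestronglyMeasurable, ?_, ?_⟩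
  · rw [hEnergy_congr hfg]
    have htail : ∀ k, Measurable (tailEnergy Ω m μ F M σ k) := fun k =>
      Measurable.tsum fun i => (hSm _).const_mul _
    refine (h3.hEnergy_le_of_pointwise htail
      (P := fun x => x ∈ bdry Ω ∧ IsTraceAt Ω m C₁ 𝔻 Ca u (f x) x) (h3.ae_mem_bdry.and hf)
      fun x y hx hy k hk1 hk2 => ho.hKer_mul_le h3 h4 h5 hu hM.le hx.1 hy.1 hx.2.1 hy.2.1
        hk1 hk2).trans ?_
    have : ∑' k, ∫⁻ x, tailEnergy Ω m μ F M σ k x ∂μ ≤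
        (1 - ENNReal.ofReal σ)⁻¹ * (C * ∫⁻ Z, F Z ∂m.restrict Ω) := by
      unfold tailEnergy
      rw [tsum_lintegral_tail hSm]
      gcongr
    calc _ ≤ B * (2 * ((C₃ : ℝ≥0∞) ^ 2 *
          ((1 - ENNReal.ofReal σ)⁻¹ * (C * ∫⁻ Z, F Z ∂m.restrict Ω)))) := by gcongr
      _ = D * ∫⁻ Z, F Z ∂m.restrict Ω := by ring
  · filter_upwards [hf, hfg] with x hx hx'
    rwa [hx']

lemma avg_congr {u u' : Rn n → ℝ} (h : u =ᵐ[m.restrict Ω] u') {X : Rn n} (hX : X ∈ Ω) :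
    avg Ω m u X = avg Ω m u' X := by
  refine average_congr (ae_mono (Measure.restrict_mono_set m ?_) h)
  exact (ball_subset_ball (half_le_self (delta_nonneg X))).trans (ball_delta_subset hX)

lemma avg_add (hΓ : (bdry Ω).Nonempty) {u u' : Rn n → ℝ} (hu : LocallyIntegrableOn u Ω m)
    (hu' : LocallyIntegrableOn u' Ω m) {X : Rn n} (hX : X ∈ Ω) :
    avg Ω m (u + u') X = avg Ω m u X + avg Ω m u' X := by
  have hδ := half_pos (delta_pos hΓ hX)
  have hB := ball_half_delta_subset hX
  simp only [avg, average_eq, Pi.add_apply]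
  rw [integral_add (integrableOn_ball hu hδ hB) (integrableOn_ball hu' hδ hB), smul_add]

lemma avg_smul (c : ℝ) (u : Rn n → ℝ) (X : Rn n) : avg Ω m (c • u) X = c * avg Ω m u X := by
  simp only [avg, average_eq, Pi.smul_apply, smul_eq_mul, integral_const_mul]
  ring

end MixedDim

/-! ### ### Linearity and assembly of the trace operator -/

open MixedDim in
theorem mainTheorem4 (n : ℕ) (Ω : TopologicalSpace.Opens (Rn n)) (m μ : Measure (Rn n))
    [IsLocallyFiniteMeasure μ]
    (C₁ : ℝ) (N : ℕ) (C₃ C₄ : ℝ≥0) (C₅ C₆ : ℝ)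
    (h1 : MixedDim.H1 Ω C₁) (h2 : MixedDim.H2 Ω C₁ N) (h3 : MixedDim.H3 Ω μ C₃)
    (h4 : MixedDim.H4 Ω m C₄) (h5 : MixedDim.H5 Ω m μ C₅) (h6 : MixedDim.H6 Ω m C₆)
    (𝔻 : MixedDim.DyadicSystem (MixedDim.bdry Ω)) (Ca : ℝ) (hCa : 1000 * C₁ * √n ≤ Ca) :
    ∃ Tr : MixedDim.W Ω m →ₗ[ℝ] MixedDim.H Ω m μ,
      (∃ C : ℝ, ∀ u : MixedDim.W Ω m, MixedDim.hNorm (Tr u) ≤ C * MixedDim.wNorm u) ∧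
      ∀ u : MixedDim.W Ω m, ∀ᵐ x ∂μ,
        Tendsto (fun X => ⨍ Z in ball X (MixedDim.δ Ω X / 2), (u : Rn n →ₘ[m.restrict Ω] ℝ) Z ∂m)
          (MixedDim.coneFilter Ω 𝔻 Ca x) (𝓝 ((Tr u : Rn n →ₘ[μ] ℝ) x)) ∧
        Tendsto (fun X => ⨍ Z in ball X (MixedDim.δ Ω X / 2),
            |(u : Rn n →ₘ[m.restrict Ω] ℝ) Z - (Tr u : Rn n →ₘ[μ] ℝ) x| ∂m)
          (MixedDim.coneFilter Ω 𝔻 Ca x) (𝓝 0) := by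
  obtain ⟨C, hC⟩ := exists_trace h1 h2 h3 h4 h5 𝔻 hCa (max C₆ 0) (le_max_right _ _)
  have hW : ∀ u : W Ω m, IsWGrad Ω m (u : Rn n →ₘ[m.restrict Ω] ℝ) (wGrad u) :=
    fun u => u.2.choose_spec
  have hex : ∀ u : W Ω m, ∃ g : Rn n →ₘ[μ] ℝ,
      hEnergy Ω m μ g ≤ C * ENNReal.ofReal (∫ Z in Ω, ‖wGrad u Z‖ ^ 2 ∂m) ∧
        ∀ᵐ x ∂μ, IsTraceAt Ω m C₁ 𝔻 Ca (u : Rn n →ₘ[m.restrict Ω] ℝ) (g x) x := by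
    intro u
    obtain ⟨F, hF, hFu⟩ := (hW u).hasPoincare h4 h6
    rw [← hFu]
    exact hC _ F hF
  choose T hTE hTr using hex
  have hmem : ∀ u, T u ∈ H Ω m μ := fun u =>
    (hTE u).trans_lt (ENNReal.mul_lt_top ENNReal.coe_lt_top ENNReal.ofReal_lt_top)
  -- At coarse scales a bounded `Ω` may have no corkscrew points and the reference point may leave
  -- `Ω`, where the averages are not controlled; only large `k` matter for the limit.
  have href : ∀ᵐ x ∂μ, ∀ᶠ k : ℤ in atTop, refPoint Ω C₁ (2 ^ (-k)) x ∈ Ω := by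
    filter_upwards [h3.ae_mem_bdry] with x hx
    obtain ⟨k₀, hk₀⟩ := exists_adm hx
    filter_upwards [eventually_ge_atTop k₀] with k hk
    exact (h1.cork_refPoint hx (hk₀.mono (two_zpow_neg_mono hk))).1
  have hadd : ∀ u u', T (u + u') = T u + T u' := by
    intro u u'
    refine AEEqFun.ext ?_
    filter_upwards [hTr u, hTr u', hTr (u + u'), href, h3.ae_mem_bdry,
      AEEqFun.coeFn_add (T u) (T u')] with x a1 a2 a3 a4 a5 a6
    rw [a6, Pi.add_apply]
    -- The chosen traces are tied to `u` by the limit of reference averages, whose centers do not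
    -- depend on `u`; additivity of averages and uniqueness of limits do the rest.
    refine tendsto_nhds_unique a3.1 ((a1.1.add a2.1).congr' ?_)
    filter_upwards [a4] with k hk
    unfold refAvg
    rw [← avg_add ⟨x, a5⟩ (hW u).1 (hW u').1 hk]
    exact avg_congr (AEEqFun.coeFn_add _ _).symm hk
  have hsmul : ∀ (c : ℝ) u, T (c • u) = c • T u := by
    intro c u
    refine AEEqFun.ext ?_
    filter_upwards [hTr u, hTr (c • u), href, AEEqFun.coeFn_smul c (T u)] with x a1 a2 a3 a4
    rw [a4, Pi.smul_apply, smul_eq_mul]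
    refine tendsto_nhds_unique a2.1 ((a1.1.const_mul c).congr' ?_)
    filter_upwards [a3] with k hk
    unfold refAvg
    rw [← avg_smul]
    exact avg_congr (AEEqFun.coeFn_smul _ _).symm hk
  refine ⟨{ toFun := fun u => ⟨T u, hmem u⟩
            map_add' := fun u u' => Subtype.ext (hadd u u')
            map_smul' := fun c u => Subtype.ext (hsmul c u) }, ⟨√C, fun u => ?_⟩, fun u => ?_⟩
  · have h0 : 0 ≤ ∫ Z in Ω, ‖wGrad u Z‖ ^ 2 ∂m := integral_nonneg fun Z => sq_nonneg _
    have h := ENNReal.toReal_mono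
      (ENNReal.mul_lt_top ENNReal.coe_lt_top ENNReal.ofReal_lt_top).ne (hTE u)
    rw [ENNReal.toReal_mul, ENNReal.toReal_ofReal h0, ENNReal.coe_toReal] at h
    unfold hNorm wNorm
    rw [← Real.sqrt_mul C.coe_nonneg]
    exact Real.sqrt_le_sqrt h
  · filter_upwards [hTr u] with x hx
    exact hx.2
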